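/- There are a fixed program $P$ for a word RAM and constants $c\in\mathbb N$ and $C\in\mathbb R$ such that the following holds. Let $G=(V,E)$ be a finite simple undirected graph with $V=\{0,\dots,n-1\}$, $n\ge 1$, and without isolated vertices (for instance any connected graph with at least two vertices), and let $w_v$, $v\in V$, be positive integers. For $S\subseteq V$ put $w(S)=\sum_{v\in S}w_v$ and $\Gamma(S)=\{v\in V: v \text{ is adjacent to some } u\in S\}$ (so $S$ and $\Gamma(S)$ may meet), and let $$\alpha^*=\min_{\emptyset\ne S\subseteq V}\frac{w(\Gamma(S))}{w(S)}$$ be the minimal $\alpha$-ratio of $G$. Given $|V|$, $|E|$, a list of the edges (each edge once, in any order and with its endpoints in any order) and the list of the weights, $P$ halts after at most $$C\cdot|V|\,|E|^2\log w(V)$$ time units and outputs integers $p\ge 0$ and $q>0$ with $p/q=\alpha^*$. That is, $\alpha^*$ can be computed in $O(|V||E|^2\log w(V))$ time. Here the word RAM is a machine with variables and zero-initialized arrays, whose programs are built from assignments, sequencing, conditionals and while-loops. Each of the operations $+$, truncated $-$, $\times$, integer division, $<$, $=$ on words, each memory access, each assignment and each test costs one time unit, and all numbers that occur are at most $w(V)^c$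 (words of $O(\log w(V))$ bits). -/

import Mathlib

/-! ### The minimal α-ratio of a vertex-weighted graph -/

namespace AlphaRatio

variable {V : Type*}

/-- The total weight `w(S)` of a finite set of vertices. -/
def weight (w : V → ℕ) (S : Finset V) : ℕ := ∑ v ∈ S, w v

open Classical in
/-- The neighbourhood `Γ(S) = ⋃_{u ∈ S} Γ(u)`; it may meet `S`. -/
noncomputable def nbhd [Fintype V] (G : SimpleGraph V) (S : Finset V) : Finset V :=
  Finset.univ.filter fun v => ∃ u ∈ S, G.Adj u v

/-- The α-ratio `w(Γ(S)) / w(S)`; only used for nonempty `S` and positive weights. -/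
noncomputable def ratio [Fintype V] (G : SimpleGraph V) (w : V → ℕ) (S : Finset V) : ℚ :=
  (weight w (nbhd G S) : ℚ) / (weight w S : ℚ)

/-- `r` is the minimum of the α-ratios of the nonempty vertex sets. -/
def IsMinRatio [Fintype V] (G : SimpleGraph V) (w : V → ℕ) (r : ℚ) : Prop :=
  IsLeast {x : ℚ | ∃ S : Finset V, S.Nonempty ∧ x = ratio G w S} r

end AlphaRatio

/-! ### A word RAM

Programs are finite texts in a small imperative language over words (natural numbers up to a
bound `W`), with scalar variables and arrays. Both are named by numerals in the program text, so a
program uses finitely many of them. Every evaluated operation, memory access, assignment and test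
costs one time unit. There is no run from which a value larger than `W` would arise. -/

namespace WordRAM

/-- The binary word operations: addition, truncated subtraction, multiplication, division rounded
down, and the comparisons `<` and `=` with result `0` or `1`. -/
inductive Op
  | add
  | sub
  | mul
  | div
  | lt
  | eq

/-- The value of a word operation. -/
def Op.apply : Op → ℕ → ℕ → ℕ
  | .add, a, b => a + b
  | .sub, a, b => a - b
  | .mul, a, b => a * b
  | .div, a, b => a / b
  | .lt, a, b => if a < b then 1 else 0
  | .eq, a, b => if a = b then 1 else 0

/-- Memory contents: the scalar variables and the arrays. -/
structure State where
  /-- the value of a variable -/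
  var : ℕ → ℕ
  /-- the value of an array at an index -/
  arr : ℕ → ℕ → ℕ

/-- The memory after writing `k` to the variable `x`. -/
def State.setVar (s : State) (x k : ℕ) : State :=
  { s with var := Function.update s.var x k }

/-- The memory after writing `k` to the array `a` at index `i`. -/
def State.setArr (s : State) (a i k : ℕ) : State :=
  { s with arr := Function.update s.arr a (Function.update (s.arr a) i k) }

/-- Expressions: constants, variables, array entries `a[i]`, and word operations. -/
inductive Expr
  | const (k : ℕ)
  | var (x : ℕ)
  | get (a : ℕ) (i : Expr)
  | op (o : Op) (e₁ e₂ : Expr)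

/-- The value of an expression. -/
def Expr.eval (s : State) : Expr → ℕ
  | .const k => k
  | .var x => s.var x
  | .get a i => s.arr a (i.eval s)
  | .op o e₁ e₂ => o.apply (e₁.eval s) (e₂.eval s)

/-- The time to evaluate an expression: one unit for each node. -/
def Expr.cost : Expr → ℕ
  | .const _ => 1
  | .var _ => 1
  | .get _ i => i.cost + 1
  | .op _ e₁ e₂ => e₁.cost + e₂.cost + 1

/-- All values (hence all array indices) arising in the evaluation of the expression are at most
`W`. -/
def Expr.Fits (W : ℕ) (s : State) : Expr → Prop
  | .const k => k ≤ W
  | .var x => s.var x ≤ W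
  | .get a i => i.Fits W s ∧ s.arr a (i.eval s) ≤ W
  | .op o e₁ e₂ => e₁.Fits W s ∧ e₂.Fits W s ∧ o.apply (e₁.eval s) (e₂.eval s) ≤ W

/-- Programs. -/
inductive Cmd
  | skip
  | assign (x : ℕ) (e : Expr)
  | store (a : ℕ) (i e : Expr)
  | seq (c₁ c₂ : Cmd)
  | ite (e : Expr) (c₁ c₂ : Cmd)
  | loop (e : Expr) (c : Cmd)

/-- `Exec W c s t s'`: with words up to `W`, the program `c` started in memory `s` halts after
exactly `t` time units with memory `s'`. A test succeeds if its value is nonzero;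
`loop e c` repeats `c` as long as the test `e` succeeds. -/
inductive Exec (W : ℕ) : Cmd → State → ℕ → State → Prop
  | skip (s : State) : Exec W .skip s 1 s
  | assign (s : State) (x : ℕ) (e : Expr) (he : e.Fits W s) :
      Exec W (.assign x e) s (e.cost + 1) (s.setVar x (e.eval s))
  | store (s : State) (a : ℕ) (i e : Expr) (hi : i.Fits W s) (he : e.Fits W s) :
      Exec W (.store a i e) s (i.cost + e.cost + 1) (s.setArr a (i.eval s) (e.eval s))
  | seq {c₁ c₂ : Cmd} {s₁ s₂ s₃ : State} {t₁ t₂ : ℕ}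
      (h₁ : Exec W c₁ s₁ t₁ s₂) (h₂ : Exec W c₂ s₂ t₂ s₃) :
      Exec W (.seq c₁ c₂) s₁ (t₁ + t₂) s₃
  | ite_true {e : Expr} {c₁ c₂ : Cmd} {s s' : State} {t : ℕ} (hf : e.Fits W s)
      (he : e.eval s ≠ 0) (h : Exec W c₁ s t s') :
      Exec W (.ite e c₁ c₂) s (e.cost + 1 + t) s'
  | ite_false {e : Expr} {c₁ c₂ : Cmd} {s s' : State} {t : ℕ} (hf : e.Fits W s)
      (he : e.eval s = 0) (h : Exec W c₂ s t s') :
      Exec W (.ite e c₁ c₂) s (e.cost + 1 + t) s'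
  | loop_done {e : Expr} {c : Cmd} {s : State} (hf : e.Fits W s) (he : e.eval s = 0) :
      Exec W (.loop e c) s (e.cost + 1) s
  | loop_step {e : Expr} {c : Cmd} {s₁ s₂ s₃ : State} {t₁ t₂ : ℕ} (hf : e.Fits W s₁)
      (he : e.eval s₁ ≠ 0) (h₁ : Exec W c s₁ t₁ s₂) (h₂ : Exec W (.loop e c) s₂ t₂ s₃) :
      Exec W (.loop e c) s₁ (e.cost + 1 + t₁ + t₂) s₃

end WordRAM

/-! ### Weighted graphs as inputs -/

namespace AlphaRatio

/-- `L` lists every edge of `G` exactly once, each as an ordered pair of its endpoints in one of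
the two orders. -/
def IsEdgeList {n : ℕ} (G : SimpleGraph (Fin n)) (L : List (Fin n × Fin n)) : Prop :=
  (L.map fun p => s(p.1, p.2)).Nodup ∧
    ∀ e : Sym2 (Fin n), e ∈ (L.map fun p => s(p.1, p.2)) ↔ e ∈ G.edgeSet

/-- The initial memory for a graph on `Fin n` with weights `w` and edge list `L`: variables `0` and
`1` hold the numbers of vertices and of edges, arrays `0` and `1` the endpoints of the edges, array
`2` the weights; everything else is `0`. -/
def inputState {n : ℕ} (w : Fin n → ℕ) (L : List (Fin n × Fin n)) : WordRAM.State where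
  var x := if x = 0 then n else if x = 1 then L.length else 0
  arr a i :=
    if a = 0 then (if h : i < L.length then ((L[i]'h).1 : ℕ) else 0)
    else if a = 1 then (if h : i < L.length then ((L[i]'h).2 : ℕ) else 0)
    else if a = 2 then (if h : i < n then w ⟨i, h⟩ else 0)
    else 0

end AlphaRatio

/-! The algorithm is Newton's (Dinkelbach's) iteration on the ratio. Given `p / q`, minimize `q *
w(Γ(S)) - p * w(S)` over `S`. If the minimum is nonnegative, `p / q` is a lower bound for all ratios
(`IsLower`); otherwise a minimizer `T` has a smaller ratio, which replaces `p / q`. The start is `S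
= V`, of ratio `1` because no vertex is isolated. The function `S ↦ w(Γ(S))` is submodular
(`nb_submodular`), so the minimizers for a strictly smaller parameter are contained in those for a
larger one (`IsMinimizer.subset`). The inclusion is strict here: a set has value `0` at its own
ratio, whereas the next one has a negative value. Hence there are `O(n)` rounds (`runs_minimize`).

A minimizer is a minimum cut. Each vertex has a sending copy with supply `p * w u` and a receiving
copy with capacity `q * w v`, and half-edges carry unlimited flow from sending to receiving copies.
The unsent supply of any flow is at least `p * w(S) - q * w(Γ(S))` (`Feasible.le_rest`), with
equality for the set reached by a search once no augmenting path is left.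

Maximum flows are found by capacity scaling. When no augmenting path of capacity `d + 1` exists, the
reached set shows that the unsent supply is within `(2n + M) * d` of the optimum (`Marked.rest_le`).
So after halving the parameter `O(n + M)` augmentations suffice (`runs_phase`), each found by a
breadth-first search in time `O(n + M)`. The parameter starts at `p * w(V) ≤ w(V)²`, which gives
`O(log w(V))` phases (`runs_scaling`). Since `M = 2m` and `n ≤ M`, the total is `O(n m² log w(V))`.

Programs are verified with timed Hoare triples `Runs`: loop-free code is reduced to arithmetic by
`wp`, loops are handled by a ranked invariant, and untouched memory is tracked by `Frame`. -/

namespace WordRAM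

/-! ### Timed Hoare logic for the word RAM -/

@[simp] theorem State.setVar_var (s : State) (x k : ℕ) (y : ℕ) :
    (s.setVar x k).var y = if y = x then k else s.var y := by
  simp [State.setVar, Function.update_apply]

@[simp] theorem State.setVar_arr (s : State) (x k : ℕ) : (s.setVar x k).arr = s.arr := rfl

@[simp] theorem State.setArr_var (s : State) (a i k : ℕ) : (s.setArr a i k).var = s.var := rfl

@[simp] theorem State.setArr_arr (s : State) (a i k b : ℕ) :
    (s.setArr a i k).arr b = if b = a then Function.update (s.arr a) i k else s.arr b := by
  simp [State.setArr, Function.update_apply]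

/-- Whether the program text assigns to the variable `x`. -/
def Cmd.writesVar (x : ℕ) : Cmd → Bool
  | .skip => false
  | .assign y _ => x == y
  | .store _ _ _ => false
  | .seq c₁ c₂ => c₁.writesVar x || c₂.writesVar x
  | .ite _ c₁ c₂ => c₁.writesVar x || c₂.writesVar x
  | .loop _ c => c.writesVar x

/-- Whether the program text stores into the array `a`. -/
def Cmd.writesArr (a : ℕ) : Cmd → Bool
  | .skip => false
  | .assign _ _ => false
  | .store b _ _ => a == b
  | .seq c₁ c₂ => c₁.writesArr a || c₂.writesArr a
  | .ite _ c₁ c₂ => c₁.writesArr a || c₂.writesArr a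
  | .loop _ c => c.writesArr a

/-- The memories agree on everything that `c` does not write. -/
structure Frame (c : Cmd) (s s' : State) : Prop where
  var : ∀ x, c.writesVar x = false → s'.var x = s.var x
  arr : ∀ a, c.writesArr a = false → s'.arr a = s.arr a

theorem Frame.refl (c : Cmd) (s : State) : Frame c s s := ⟨fun _ _ => rfl, fun _ _ => rfl⟩

theorem Frame.trans {c : Cmd} {s₁ s₂ s₃ : State} (h₁ : Frame c s₁ s₂) (h₂ : Frame c s₂ s₃) :
    Frame c s₁ s₃ :=
  ⟨fun x hx => (h₂.var x hx).trans (h₁.var x hx), fun a ha => (h₂.arr a ha).trans (h₁.arr a ha)⟩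

/-- What a program writes is computed from its text, so for concrete programs the side conditions of
a frame hold by `rfl` or `decide`. Facts about other variables and arrays therefore need no place in
the invariants. -/
theorem Exec.frame {W : ℕ} {c : Cmd} {s s' : State} {t : ℕ} (h : Exec W c s t s') :
    Frame c s s' := by
  induction h with
  | skip s => exact Frame.refl _ _
  | assign s x e he =>
    refine ⟨fun y hy => ?_, fun _ _ => rfl⟩
    have : y ≠ x := by simpa [Cmd.writesVar] using hy
    simp [this]
  | store s a i e hi he =>
    refine ⟨fun _ _ => rfl, fun b hb => ?_⟩
    have : b ≠ a := by simpa [Cmd.writesArr] using hb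
    simp [this]
  | seq _ _ ih₁ ih₂ =>
    refine ⟨fun x hx => ?_, fun a ha => ?_⟩
    · simp only [Cmd.writesVar, Bool.or_eq_false_iff] at hx
      exact (ih₂.var x hx.2).trans (ih₁.var x hx.1)
    · simp only [Cmd.writesArr, Bool.or_eq_false_iff] at ha
      exact (ih₂.arr a ha.2).trans (ih₁.arr a ha.1)
  | ite_true _ _ _ ih =>
    refine ⟨fun x hx => ?_, fun a ha => ?_⟩
    · simp only [Cmd.writesVar, Bool.or_eq_false_iff] at hx
      exact ih.var x hx.1
    · simp only [Cmd.writesArr, Bool.or_eq_false_iff] at ha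
      exact ih.arr a ha.1
  | ite_false _ _ _ ih =>
    refine ⟨fun x hx => ?_, fun a ha => ?_⟩
    · simp only [Cmd.writesVar, Bool.or_eq_false_iff] at hx
      exact ih.var x hx.2
    · simp only [Cmd.writesArr, Bool.or_eq_false_iff] at ha
      exact ih.arr a ha.2
  | loop_done _ _ => exact Frame.refl _ _
  | loop_step _ _ _ _ ih₁ ih₂ =>
    exact ⟨fun x hx => (ih₂.var x hx).trans (ih₁.var x hx),
      fun a ha => (ih₂.arr a ha).trans (ih₁.arr a ha)⟩

/-- Started in memory `s`, the program `c` halts within `T` time units in a memory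
satisfying `Q`. -/
def Runs (W : ℕ) (c : Cmd) (T : ℕ) (s : State) (Q : State → Prop) : Prop :=
  ∃ t s', Exec W c s t s' ∧ t ≤ T ∧ Q s'

variable {W : ℕ}

theorem Runs.mono {c : Cmd} {T T' : ℕ} {s : State} {Q Q' : State → Prop} (h : Runs W c T s Q)
    (hT : T ≤ T') (hQ : ∀ s', Frame c s s' → Q s' → Q' s') : Runs W c T' s Q' := by
  obtain ⟨t, s', h₁, h₂, h₃⟩ := h
  exact ⟨t, s', h₁, h₂.trans hT, hQ s' h₁.frame h₃⟩

theorem Runs.seq {c₁ c₂ : Cmd} {T₁ T₂ : ℕ} {s : State} {Q : State → Prop}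
    (h : Runs W c₁ T₁ s fun s' => Runs W c₂ T₂ s' Q) : Runs W (.seq c₁ c₂) (T₁ + T₂) s Q := by
  obtain ⟨t, s', h₁, h₂, t', s'', h₃, h₄, h₅⟩ := h
  exact ⟨t + t', s'', .seq h₁ h₃, by omega, h₅⟩

/-- Sequencing, with the frame of the first program at hand for the second one. -/
theorem Runs.seq' {c₁ c₂ : Cmd} {T₁ T₂ : ℕ} {s : State} {Q₁ Q : State → Prop}
    (h₁ : Runs W c₁ T₁ s Q₁) (h₂ : ∀ s', Frame c₁ s s' → Q₁ s' → Runs W c₂ T₂ s' Q) :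
    Runs W (.seq c₁ c₂) (T₁ + T₂) s Q :=
  .seq (h₁.mono le_rfl h₂)

theorem Runs.ite {e : Expr} {c₁ c₂ : Cmd} {T : ℕ} {s : State} {Q : State → Prop}
    (hf : e.Fits W s) (h₁ : e.eval s ≠ 0 → Runs W c₁ T s Q) (h₂ : e.eval s = 0 → Runs W c₂ T s Q) :
    Runs W (.ite e c₁ c₂) (e.cost + 1 + T) s Q := by
  by_cases he : e.eval s = 0
  · obtain ⟨t, s', h, ht, hQ⟩ := h₂ he
    exact ⟨_, s', .ite_false hf he h, by omega, hQ⟩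
  · obtain ⟨t, s', h, ht, hQ⟩ := h₁ he
    exact ⟨_, s', .ite_true hf he h, by omega, hQ⟩

/-- A loop with an invariant indexed by a bound for the number of remaining rounds. -/
theorem Runs.loop {e : Expr} {c : Cmd} {B k : ℕ} {s : State} (I : ℕ → State → Prop)
    (h0 : I k s)
    (hstep : ∀ k s', Frame c s s' → I k s' → e.Fits W s' ∧
      (e.eval s' ≠ 0 → Runs W c B s' fun s'' => ∃ k' < k, I k' s'')) :
    Runs W (.loop e c) ((k + 1) * (e.cost + 1 + B)) s
      fun s' => ∃ k', I k' s' ∧ e.eval s' = 0 := by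
  suffices H : ∀ k s', Frame c s s' → I k s' →
      Runs W (.loop e c) ((k + 1) * (e.cost + 1 + B)) s' fun s' => ∃ k', I k' s' ∧ e.eval s' = 0 from
    H k s (Frame.refl _ _) h0
  intro k
  induction k using Nat.strong_induction_on with
  | _ k ih =>
    intro s' hF hI
    obtain ⟨hf, hb⟩ := hstep k s' hF hI
    by_cases he : e.eval s' = 0
    · exact ⟨_, s', .loop_done hf he, by nlinarith, k, hI, he⟩
    · obtain ⟨t₁, s₁, h₁, ht₁, k', hk', hI'⟩ := hb he
      obtain ⟨t₂, s₂, h₂, ht₂, hQ⟩ := ih k' hk' s₁ (hF.trans h₁.frame) hI'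
      refine ⟨_, s₂, .loop_step hf he h₁ h₂, ?_, hQ⟩
      -- The rank falls from `k` to `k' < k`, which frees at least one multiple of the cost of a
      -- round; it pays for the round just made.
      have : (k' + 1) * (e.cost + 1 + B) ≤ k * (e.cost + 1 + B) := Nat.mul_le_mul_right _ hk'
      have h3 : (k + 1) * (e.cost + 1 + B) = k * (e.cost + 1 + B) + (e.cost + 1 + B) := by ring
      omega

/-- A bound for the running time of a loop-free program. -/
def Cmd.flatCost : Cmd → ℕ
  | .skip => 1
  | .assign _ e => e.cost + 1
  | .store _ i e => i.cost + e.cost + 1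
  | .seq c₁ c₂ => c₁.flatCost + c₂.flatCost
  | .ite e c₁ c₂ => e.cost + 1 + max c₁.flatCost c₂.flatCost
  | .loop _ _ => 0

/-- The weakest precondition of a loop-free program. -/
def wp (W : ℕ) : Cmd → State → (State → Prop) → Prop
  | .skip, s, Q => Q s
  | .assign x e, s, Q => e.Fits W s ∧ Q (s.setVar x (e.eval s))
  | .store a i e, s, Q => i.Fits W s ∧ e.Fits W s ∧ Q (s.setArr a (i.eval s) (e.eval s))
  | .seq c₁ c₂, s, Q => wp W c₁ s fun s' => wp W c₂ s' Q
  | .ite e c₁ c₂, s, Q => e.Fits W s ∧ (e.eval s ≠ 0 → wp W c₁ s Q) ∧ (e.eval s = 0 → wp W c₂ s Q)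
  | .loop _ _, _, _ => False

/-- `wp` is false on loops, so the value `0` of `flatCost` there is never used. For concrete code
the cost bound is a comparison of numerals. -/
theorem Runs.of_wp {c : Cmd} {B : ℕ} {s : State} {Q : State → Prop} (h : wp W c s Q)
    (hB : c.flatCost ≤ B := by decide) : Runs W c B s Q := by
  refine Runs.mono (T := c.flatCost) (Q := Q) ?_ hB fun _ _ h => h
  clear hB
  induction c generalizing s Q with
  | skip => exact ⟨1, s, .skip s, le_rfl, h⟩
  | assign x e => exact ⟨_, _, .assign s x e h.1, le_rfl, h.2⟩
  | store a i e => exact ⟨_, _, .store s a i e h.1 h.2.1, le_rfl, h.2.2⟩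
  | seq c₁ c₂ ih₁ ih₂ => exact .seq ((ih₁ h).mono le_rfl fun s' _ h' => ih₂ h')
  | ite e c₁ c₂ ih₁ ih₂ =>
    exact .ite h.1 (fun he => (ih₁ (h.2.1 he)).mono (le_max_left _ _) fun _ _ h => h)
      fun he => (ih₂ (h.2.2 he)).mono (le_max_right _ _) fun _ _ h => h
  | loop e c ih => exact h.elim

/-- `for i < e do c`. -/
def Cmd.for (i : ℕ) (e : Expr) (c : Cmd) : Cmd :=
  .seq (.assign i (.const 0)) (.loop (.op .lt (.var i) e)
    (.seq c (.assign i (.op .add (.var i) (.const 1)))))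

/-- A round costs `e.cost + B + 7`: test, body and increment. The two extra units per round cover
the initial assignment. The bound `e` is evaluated anew in every round, hence the demand that its
value stay `N` throughout the frame; `N < W` lets the counter and the result of the test fit. -/
theorem Runs.forLoop {i : ℕ} {e : Expr} {c : Cmd} {T N : ℕ} {s : State} (B : ℕ)
    (I : ℕ → State → Prop) (hT : (N + 1) * (e.cost + B + 9) ≤ T)
    (hi : c.writesVar i = false) (hN : N < W)
    (he : ∀ s', Frame (.for i e c) s s' → e.eval s' = N ∧ e.Fits W s')
    (h0 : I 0 (s.setVar i 0))
    (hstep : ∀ j s', Frame (.for i e c) s s' → j < N → s'.var i = j → I j s' →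
      Runs W c B s' fun s'' => I (j + 1) (s''.setVar i (j + 1))) :
    Runs W (.for i e c) T s (I N) := by
  have h1 : Frame (.for i e c) s (s.setVar i 0) := by
    refine ⟨fun x hx => ?_, fun _ _ => rfl⟩
    have : x ≠ i := by
      rintro rfl; simp [Cmd.for, Cmd.writesVar] at hx
    simp [this]
  have h2 := Runs.loop (W := W) (e := .op .lt (.var i) e)
    (c := .seq c (.assign i (.op .add (.var i) (.const 1)))) (B := B + 4) (k := N)
    (s := s.setVar i 0)
    (fun k s' => ∃ j, s'.var i = j ∧ j + k = N ∧ I j s') ⟨0, by simp, by omega, h0⟩ ?_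
  · obtain ⟨t, s', a1, a2, k, ⟨j, b1, b2, b3⟩, a3⟩ := h2
    refine ⟨_, s', .seq (.assign s i (.const 0) (Nat.zero_le _)) a1, ?_, ?_⟩
    · simp only [Expr.cost] at a2 ⊢
      have : (N + 1) * (e.cost + B + 9) = (N + 1) * (1 + e.cost + 1 + 1 + (B + 4)) + 2 * (N + 1) := by
        ring
      omega
    · have h3 := he s' (h1.trans ⟨fun x hx => a1.frame.var x (by simp_all [Cmd.for, Cmd.writesVar]),
        fun x hx => a1.frame.arr x (by simp_all [Cmd.for, Cmd.writesArr])⟩)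
      simp only [Expr.eval, Op.apply, h3, b1] at a3
      have : j = N := by
        split_ifs at a3; omega
      exact this ▸ b3
  · rintro k s' hF ⟨j, hj, hk, hI⟩
    have hF' : Frame (.for i e c) s s' :=
      h1.trans ⟨fun x hx => hF.var x (by simp_all [Cmd.for, Cmd.writesVar]),
        fun x hx => hF.arr x (by simp_all [Cmd.for, Cmd.writesArr])⟩
    obtain ⟨h3, h4⟩ := he s' hF'
    refine ⟨?_, ?_⟩
    · simp only [Expr.Fits, Expr.eval, Op.apply, h3, hj]
      refine ⟨by omega, h4, ?_⟩
      split_ifs <;> omega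
    · intro h
      simp only [Expr.eval, Op.apply, h3, hj] at h
      have hjN : j < N := by
        by_contra hc; simp [hc] at h
      refine Runs.seq' (T₂ := 4) (hstep j s' hF' hjN hj hI) fun s'' hF'' h' => ?_
      have e1 : s''.var i = j := (hF''.var i hi).trans hj
      refine (Runs.of_wp (c := .assign i (.op .add (.var i) (.const 1)))
        (Q := fun s => ∃ k' < k, ∃ j, s.var i = j ∧ j + k' = N ∧ I j s) ?_ le_rfl)
      simp only [wp, Expr.Fits, Expr.eval, Op.apply, e1]
      exact ⟨by omega, k - 1, by omega, j + 1, by simp, by omega, h'⟩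

end WordRAM

/-! ### Networks, submodularity and the deficiency bound -/

open Finset

/-- A weighted graph on `{0, …, n - 1}` given by `M` half-edges: `h` leads from `tl h` to `hd h`,
`tw h` is the opposite half-edge. The half-edges with tail `u` form a linked list: with `h`
represented by `h + 1` and the end by `0`, its head is `hh u`, and `nx h` is the successor of `h`;
the numbers decrease along the list. -/
structure Net where
  /-- the number of vertices -/
  n : ℕ
  /-- the number of half-edges -/
  M : ℕ
  /-- the tail of a half-edge -/
  tl : ℕ → ℕ
  /-- the head of a half-edge -/
  hd : ℕ → ℕ
  /-- the opposite half-edge -/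
  tw : ℕ → ℕ
  /-- the successor in the linked list -/
  nx : ℕ → ℕ
  /-- the head of the linked list -/
  hh : ℕ → ℕ
  /-- the weights -/
  w : ℕ → ℕ
  tl_lt : ∀ h < M, tl h < n
  hd_lt : ∀ h < M, hd h < n
  tw_lt : ∀ h < M, tw h < M
  tl_tw : ∀ h < M, tl (tw h) = hd h
  hd_tw : ∀ h < M, hd (tw h) = tl h
  tw_tw : ∀ h < M, tw (tw h) = h
  -- Completeness of the lists is expressed by bounds: all half-edges with tail `u` lie below `hh
  -- u`, and all earlier ones with the tail of `h` lie below `nx h`, so that a traversal skips none.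
  lt_hh : ∀ h < M, h < hh (tl h)
  hh_le : ∀ u < n, hh u ≤ M
  tl_hh : ∀ u < n, hh u ≠ 0 → tl (hh u - 1) = u
  nx_le : ∀ h < M, nx h ≤ h
  lt_nx : ∀ h < M, ∀ h' < h, tl h' = tl h → h' < nx h
  tl_nx : ∀ h < M, nx h ≠ 0 → tl (nx h - 1) = tl h
  n_pos : 0 < n
  w_pos : ∀ u < n, 0 < w u
  exists_tl : ∀ u < n, ∃ h < M, tl h = u

namespace Net

variable (N : Net)

/-- The weight of a vertex set. -/
def wt (S : Finset ℕ) : ℕ := ∑ u ∈ S, N.w u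

/-- The neighbourhood of a vertex set. -/
def nb (S : Finset ℕ) : Finset ℕ :=
  (range N.n).filter fun v => ∃ h < N.M, N.tl h ∈ S ∧ N.hd h = v

/-- The flow out of `u`. -/
def outflow (x : ℕ → ℕ) (u : ℕ) : ℕ := ∑ h ∈ range N.M, if N.tl h = u then x h else 0

/-- The flow into `v`. -/
def inflow (x : ℕ → ℕ) (v : ℕ) : ℕ := ∑ h ∈ range N.M, if N.hd h = v then x h else 0

/-- `x` is a flow on the half-edges in which `r u` of the supply `p * w u` of `u` is not sent and
`sl v` of the capacity `q * w v` of `v` is not used. -/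
structure Feasible (p q : ℕ) (r sl x : ℕ → ℕ) : Prop where
  out : ∀ u < N.n, r u + N.outflow x u = p * N.w u
  inn : ∀ v < N.n, sl v + N.inflow x v = q * N.w v

/-- The supply that is not sent. -/
def rest (r : ℕ → ℕ) : ℕ := ∑ u ∈ range N.n, r u

variable {N}

theorem mem_nb {S : Finset ℕ} {v : ℕ} :
    v ∈ N.nb S ↔ ∃ h < N.M, N.tl h ∈ S ∧ N.hd h = v := by
  simp only [nb, mem_filter, mem_range, and_iff_right_iff_imp]
  rintro ⟨h, hh, -, rfl⟩
  exact N.hd_lt h hh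

theorem nb_subset (S : Finset ℕ) : N.nb S ⊆ range N.n := filter_subset _ _

theorem wt_mono {S T : Finset ℕ} (h : S ⊆ T) : N.wt S ≤ N.wt T :=
  sum_le_sum_of_subset h

theorem wt_union_add_inter (S T : Finset ℕ) : N.wt (S ∪ T) + N.wt (S ∩ T) = N.wt S + N.wt T :=
  sum_union_inter

theorem wt_pos {S : Finset ℕ} (hS : S ⊆ range N.n) (h : S.Nonempty) : 0 < N.wt S :=
  sum_pos (fun u hu => N.w_pos u (mem_range.1 (hS hu))) h

/-- Each vertex is the tail of a half-edge, whose twin leads into it. This gives the initial ratio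
`1` of the iteration. -/
theorem nb_range : N.nb (range N.n) = range N.n := by
  ext v
  rw [mem_nb, mem_range]
  constructor
  · rintro ⟨h, hh, -, rfl⟩
    exact N.hd_lt h hh
  · intro hv
    obtain ⟨h, hh, rfl⟩ := N.exists_tl v hv
    exact ⟨N.tw h, N.tw_lt h hh, mem_range.2 (N.tl_tw h hh ▸ N.hd_lt h hh), N.hd_tw h hh⟩

/-- Keeps the numerator of the current ratio positive, hence also the initial scaling parameter. -/
theorem nb_nonempty {S : Finset ℕ} (hS : S ⊆ range N.n) (h : S.Nonempty) : (N.nb S).Nonempty := by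
  obtain ⟨u, hu⟩ := h
  obtain ⟨e, he, h⟩ := N.exists_tl u (mem_range.1 (hS hu))
  exact ⟨N.hd e, mem_nb.2 ⟨e, he, h ▸ hu, rfl⟩⟩

/-- The weight is modular, and `Γ(S ∪ T) ⊆ Γ(S) ∪ Γ(T)`, `Γ(S ∩ T) ⊆ Γ(S) ∩ Γ(T)`. -/
theorem nb_submodular (S T : Finset ℕ) :
    N.wt (N.nb (S ∪ T)) + N.wt (N.nb (S ∩ T)) ≤ N.wt (N.nb S) + N.wt (N.nb T) := by
  rw [← wt_union_add_inter (N.nb S)]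
  apply add_le_add
  · apply wt_mono
    intro v hv
    obtain ⟨h, hh, h1, h2⟩ := mem_nb.1 hv
    rcases mem_union.1 h1 with h1 | h1
    · exact mem_union_left _ (mem_nb.2 ⟨h, hh, h1, h2⟩)
    · exact mem_union_right _ (mem_nb.2 ⟨h, hh, h1, h2⟩)
  · apply wt_mono
    intro v hv
    obtain ⟨h, hh, h1, h2⟩ := mem_nb.1 hv
    rw [mem_inter] at h1 ⊢
    exact ⟨mem_nb.2 ⟨h, hh, h1.1, h2⟩, mem_nb.2 ⟨h, hh, h1.2, h2⟩⟩

/-- `S` minimizes `q * w(Γ(S)) - p * w(S)`. -/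
def IsMinimizer (N : Net) (p q : ℕ) (S : Finset ℕ) : Prop :=
  ∀ T ⊆ range N.n, q * N.wt (N.nb S) + p * N.wt T ≤ q * N.wt (N.nb T) + p * N.wt S

/-- When the parameter `p / q` decreases, minimizers shrink. -/
theorem IsMinimizer.subset {p q p' q' : ℕ} {S T : Finset ℕ} (hS : N.IsMinimizer p q S)
    (hT : N.IsMinimizer p' q' T) (hSV : S ⊆ range N.n) (hTV : T ⊆ range N.n)
    (hlt : p' * q < p * q') : T ⊆ S := by
  -- Let `d` be the weight of `T \ S`. By minimality of `S`, adding `T \ S` to `S` raises `w(Γ)` by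
  -- at least `(p / q) * d`; by minimality of `T`, adding it to `S ∩ T` raises `w(Γ)` by at most
  -- `(p' / q') * d`. Submodularity bounds the first increase by the second, so `d = 0`, and
  -- positive weights make `T \ S` empty.
  have h1 := hS (S ∪ T) (union_subset hSV hTV)
  have h2 := hT (S ∩ T) (inter_subset_left.trans hSV)
  have h3 := N.nb_submodular S T
  have h4 := N.wt_union_add_inter S T
  have h5 : N.wt (S ∪ T) = N.wt S + N.wt (T \ S) := by
    rw [union_comm, ← sdiff_union_self_eq_union, wt, sum_union sdiff_disjoint, add_comm]; rfl
  have h6 : N.wt (T \ S) = 0 := by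
    by_contra h0
    have h0 : 0 < N.wt (T \ S) := Nat.pos_of_ne_zero h0
    zify at *
    generalize (N.wt (T \ S) : ℤ) = d at *
    have a1 : (p : ℤ) * d ≤ q * (N.wt (N.nb (S ∪ T)) - N.wt (N.nb S)) := by
      rw [h5] at h1; linarith
    have a2 : (q' : ℤ) * (N.wt (N.nb T) - N.wt (N.nb (S ∩ T))) ≤ p' * d := by
      have : (N.wt T : ℤ) = N.wt (S ∩ T) + d := by linarith
      rw [this] at h2; linarith
    have a3 : (q : ℤ) * (N.wt (N.nb (S ∪ T)) - N.wt (N.nb S)) ≤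
        q * (N.wt (N.nb T) - N.wt (N.nb (S ∩ T))) :=
      mul_le_mul_of_nonneg_left (by linarith) (by positivity)
    have a4 := mul_le_mul_of_nonneg_left (a1.trans a3) (Int.natCast_nonneg q')
    have a5 := mul_le_mul_of_nonneg_left a2 (Int.natCast_nonneg q)
    nlinarith
  rw [← sdiff_eq_empty_iff_subset]
  by_contra h
  exact (wt_pos (sdiff_subset.trans hTV) (nonempty_iff_ne_empty.2 h)).ne' h6

theorem sum_outflow (x : ℕ → ℕ) (S : Finset ℕ) :
    ∑ u ∈ S, N.outflow x u = ∑ h ∈ range N.M, if N.tl h ∈ S then x h else 0 := by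
  simp only [outflow]
  rw [sum_comm]
  simp

theorem sum_inflow (x : ℕ → ℕ) (S : Finset ℕ) :
    ∑ u ∈ S, N.inflow x u = ∑ h ∈ range N.M, if N.hd h ∈ S then x h else 0 := by
  simp only [inflow]
  rw [sum_comm]
  simp

namespace Feasible

variable {p q : ℕ} {r sl x : ℕ → ℕ}

theorem sum_out (hF : N.Feasible p q r sl x) {S : Finset ℕ} (hS : S ⊆ range N.n) :
    p * N.wt S = ∑ u ∈ S, r u + ∑ h ∈ range N.M, if N.tl h ∈ S then x h else 0 := by
  rw [wt, mul_sum, ← sum_outflow, ← sum_add_distrib]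
  exact sum_congr rfl fun u hu => (hF.out u (mem_range.1 (hS hu))).symm

theorem sum_inn (hF : N.Feasible p q r sl x) {S : Finset ℕ} (hS : S ⊆ range N.n) :
    q * N.wt S = ∑ u ∈ S, sl u + ∑ h ∈ range N.M, if N.hd h ∈ S then x h else 0 := by
  rw [wt, mul_sum, ← sum_inflow, ← sum_add_distrib]
  exact sum_congr rfl fun u hu => (hF.inn u (mem_range.1 (hS hu))).symm

/-- The unsent supply is at least the deficiency of every vertex set. -/
theorem le_rest (hF : N.Feasible p q r sl x) {S : Finset ℕ} (hS : S ⊆ range N.n) :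
    p * N.wt S ≤ N.rest r + q * N.wt (N.nb S) := by
  rw [hF.sum_out hS, hF.sum_inn (nb_subset S)]
  have h1 : ∑ u ∈ S, r u ≤ N.rest r := sum_le_sum_of_subset hS
  -- All flow that leaves `S` enters `Γ(S)`.
  have h2 : (∑ h ∈ range N.M, if N.tl h ∈ S then x h else 0) ≤
      ∑ h ∈ range N.M, if N.hd h ∈ N.nb S then x h else 0 := by
    apply sum_le_sum
    intro h hh
    by_cases hS : N.tl h ∈ S
    · rw [if_pos hS, if_pos (mem_nb.2 ⟨h, mem_range.1 hh, hS, rfl⟩)]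
    · rw [if_neg hS]; exact Nat.zero_le _
  omega

/-- If no residual capacity above `d` leaves the vertices of `S` and their neighbours, the unsent
supply is close to the deficiency of `S`. -/
theorem rest_le (hF : N.Feasible p q r sl x) {S : Finset ℕ} (hS : S ⊆ range N.n) {d : ℕ}
    (h1 : ∀ u < N.n, u ∉ S → r u ≤ d) (h2 : ∀ v ∈ N.nb S, sl v ≤ d)
    (h3 : ∀ h < N.M, N.tl h ∉ S → N.hd h ∈ N.nb S → x h ≤ d) :
    N.rest r + q * N.wt (N.nb S) ≤ p * N.wt S + (2 * N.n + N.M) * d := by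
  rw [hF.sum_out hS, hF.sum_inn (nb_subset S)]
  -- The error has three sources: unsent supply outside `S` (at most `n` vertices), unused capacity
  -- in `Γ(S)` (at most `n`), and flow into `Γ(S)` from outside `S` (at most `M` half-edges), each
  -- of size at most `d`.
  have a1 : N.rest r ≤ ∑ u ∈ S, r u + N.n * d := by
    rw [rest, ← sum_sdiff hS, add_comm]
    refine Nat.add_le_add_left ((sum_le_card_nsmul _ _ d fun u hu => ?_).trans ?_) _
    · rw [mem_sdiff, mem_range] at hu
      exact h1 u hu.1 hu.2
    · rw [smul_eq_mul]
      exact Nat.mul_le_mul_right _ ((card_le_card sdiff_subset).trans (card_range _).le)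
  have a2 : ∑ v ∈ N.nb S, sl v ≤ N.n * d := by
    refine (sum_le_card_nsmul _ _ d h2).trans ?_
    rw [smul_eq_mul]
    exact Nat.mul_le_mul_right _ ((card_le_card (nb_subset S)).trans (card_range _).le)
  have a3 : (∑ h ∈ range N.M, if N.hd h ∈ N.nb S then x h else 0) ≤
      (∑ h ∈ range N.M, if N.tl h ∈ S then x h else 0) + N.M * d := by
    have : N.M * d = ∑ h ∈ range N.M, d := by simp
    rw [this, ← sum_add_distrib]
    apply sum_le_sum
    intro h hh
    by_cases c1 : N.hd h ∈ N.nb S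
    · by_cases c2 : N.tl h ∈ S
      · simp [c1, c2]
      · simpa [c1, c2] using h3 h (mem_range.1 hh) c2 c1
    · simp [c1]
  have a4 : (2 * N.n + N.M) * d = N.n * d + N.n * d + N.M * d := by ring
  omega

end Feasible

/-- The old contribution is added on the left because subtraction on `ℕ` is truncated. -/
theorem outflow_update {x : ℕ → ℕ} {h : ℕ} (hh : h < N.M) (y u : ℕ) :
    N.outflow (Function.update x h y) u + (if N.tl h = u then x h else 0) =
      N.outflow x u + if N.tl h = u then y else 0 := by
  have hm := mem_range.2 hh
  simp only [outflow]
  rw [← sum_erase_add _ _ hm, ← sum_erase_add (range N.M) (fun h => if N.tl h = u then x h else 0) hm,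
    Function.update_self,
    sum_congr rfl fun k hk => by rw [Function.update_of_ne (ne_of_mem_erase hk)]]
  omega

theorem inflow_update {x : ℕ → ℕ} {h : ℕ} (hh : h < N.M) (y v : ℕ) :
    N.inflow (Function.update x h y) v + (if N.hd h = v then x h else 0) =
      N.inflow x v + if N.hd h = v then y else 0 := by
  have hm := mem_range.2 hh
  simp only [inflow]
  rw [← sum_erase_add _ _ hm, ← sum_erase_add (range N.M) (fun h => if N.hd h = v then x h else 0) hm,
    Function.update_self,
    sum_congr rfl fun k hk => by rw [Function.update_of_ne (ne_of_mem_erase hk)]]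
  omega

theorem outflow_add {x : ℕ → ℕ} {h : ℕ} (hh : h < N.M) (d u : ℕ) :
    N.outflow (Function.update x h (x h + d)) u = N.outflow x u + if N.tl h = u then d else 0 := by
  have := outflow_update hh (x := x) (x h + d) u
  split_ifs at this ⊢ <;> omega

theorem inflow_add {x : ℕ → ℕ} {h : ℕ} (hh : h < N.M) (d u : ℕ) :
    N.inflow (Function.update x h (x h + d)) u = N.inflow x u + if N.hd h = u then d else 0 := by
  have := inflow_update hh (x := x) (x h + d) u
  split_ifs at this ⊢ <;> omega

theorem outflow_sub {x : ℕ → ℕ} {h d : ℕ} (hh : h < N.M) (hd : d ≤ x h) (u : ℕ) :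
    N.outflow (Function.update x h (x h - d)) u + (if N.tl h = u then d else 0) =
      N.outflow x u := by
  have := outflow_update hh (x := x) (x h - d) u
  split_ifs at this ⊢ <;> omega

theorem inflow_sub {x : ℕ → ℕ} {h d : ℕ} (hh : h < N.M) (hd : d ≤ x h) (u : ℕ) :
    N.inflow (Function.update x h (x h - d)) u + (if N.hd h = u then d else 0) =
      N.inflow x u := by
  have := inflow_update hh (x := x) (x h - d) u
  split_ifs at this ⊢ <;> omega

theorem le_inflow {x : ℕ → ℕ} {h : ℕ} (hh : h < N.M) : x h ≤ N.inflow x (N.hd h) := by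
  have := single_le_sum (f := fun k => if N.hd k = N.hd h then x k else 0)
    (fun _ _ => Nat.zero_le _) (mem_range.2 hh)
  simpa [inflow] using this

end Net

/-! ### Breadth-first search and augmenting paths -/

namespace Net

variable (N : Net)

/-- The vertex of the graph that belongs to a node of the flow network: `u < n` stands for the
sending and `n + v` for the receiving copy of a vertex. -/
def base (z : ℕ) : ℕ := if z < N.n then z else z - N.n

/-- Which nodes have been marked by a search for augmenting paths of capacity `d`: `pr z` is `0` for
an unmarked node, `1` for a starting node, and otherwise `h + 2` with `h` the half-edge through which
`z` was reached. Parents have smaller rank `ord`. -/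
structure Marked (d : ℕ) (r x pr ord : ℕ → ℕ) : Prop where
  ord_lt : ∀ z < 2 * N.n, pr z ≠ 0 → ord z < 2 * N.n
  roots : ∀ u < N.n, d ≤ r u → pr u ≠ 0
  right : ∀ v < N.n, pr (N.n + v) ≠ 0 → ∃ h < N.M, pr (N.n + v) = h + 2 ∧ N.hd h = v ∧
    pr (N.tl h) ≠ 0 ∧ ord (N.tl h) < ord (N.n + v)
  left : ∀ u < N.n, pr u ≠ 0 → pr u = 1 ∧ d ≤ r u ∨ ∃ h < N.M, pr u = h + 2 ∧ N.hd h = u ∧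
    d ≤ x (N.tw h) ∧ pr (N.n + N.tl h) ≠ 0 ∧ ord (N.n + N.tl h) < ord u
  closed : ∀ h < N.M, pr (N.tl h) ≠ 0 → pr (N.n + N.hd h) ≠ 0
  closed' : ∀ h < N.M, pr (N.n + N.tl h) ≠ 0 → d ≤ x (N.tw h) → pr (N.hd h) ≠ 0

/-- The state of a search: the queue `Q` holds `qt` nodes, the lists of the first `qh` of them have
been scanned, except for the part of the list of the last one, `z`, that starts at `e`. -/
structure Searching (d : ℕ) (r x pr ord Q : ℕ → ℕ) (qh qt e z : ℕ) : Prop where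
  ord_lt : ∀ y < 2 * N.n, pr y ≠ 0 → ord y < qt ∧ Q (ord y) = y
  queue : ∀ i < qt, Q i < 2 * N.n ∧ pr (Q i) ≠ 0 ∧ ord (Q i) = i
  roots : ∀ u < N.n, d ≤ r u → pr u ≠ 0
  right : ∀ v < N.n, pr (N.n + v) ≠ 0 → ∃ h < N.M, pr (N.n + v) = h + 2 ∧ N.hd h = v ∧
    pr (N.tl h) ≠ 0 ∧ ord (N.tl h) < ord (N.n + v)
  left : ∀ u < N.n, pr u ≠ 0 → pr u = 1 ∧ d ≤ r u ∨ ∃ h < N.M, pr u = h + 2 ∧ N.hd h = u ∧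
    d ≤ x (N.tw h) ∧ pr (N.n + N.tl h) ≠ 0 ∧ ord (N.n + N.tl h) < ord u
  -- A list runs through decreasing numbers and `e` stands for the half-edge `e - 1`, so what
  -- remains to be scanned at `z` lies below `e`. The function `ord`, the position in the queue,
  -- exists only in the proof.
  closed : ∀ h < N.M, pr (N.tl h) ≠ 0 → ord (N.tl h) < qh →
    pr (N.n + N.hd h) ≠ 0 ∨ z = N.tl h ∧ h < e
  closed' : ∀ h < N.M, pr (N.n + N.tl h) ≠ 0 → ord (N.n + N.tl h) < qh → d ≤ x (N.tw h) →
    pr (N.hd h) ≠ 0 ∨ z = N.n + N.tl h ∧ h < e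
  current : e ≠ 0 → z < 2 * N.n ∧ pr z ≠ 0 ∧ ord z < qh ∧ e ≤ N.M ∧ N.tl (e - 1) = N.base z
  qh_le : qh ≤ qt

/-- The number of half-edges below `e` with tail `b`. -/
def listLen (b e : ℕ) : ℕ := ((range e).filter fun h => N.tl h = b).card

/-- The remaining work of a search. -/
def searchWork (pr ord : ℕ → ℕ) (qh e z : ℕ) : ℕ :=
  ∑ y ∈ (range (2 * N.n)).filter (fun y => ¬ (pr y ≠ 0 ∧ ord y < qh)),
    (N.listLen (N.base y) N.M + 1) + N.listLen (N.base z) e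

variable {N}

theorem base_lt {z : ℕ} (hz : z < 2 * N.n) : N.base z < N.n := by
  unfold base; split_ifs <;> omega

theorem base_left {u : ℕ} (hu : u < N.n) : N.base u = u := if_pos hu

theorem base_right (v : ℕ) : N.base (N.n + v) = v := by simp [base]

theorem listLen_mono (b : ℕ) {e e' : ℕ} (h : e ≤ e') : N.listLen b e ≤ N.listLen b e' :=
  card_le_card (filter_subset_filter _ (range_mono h))

theorem listLen_lt {b e e' : ℕ} (h : e' < e) (hb : N.tl (e - 1) = b) :
    N.listLen b e' < N.listLen b e := by
  apply card_lt_card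
  refine ⟨filter_subset_filter _ (range_mono h.le), fun hc => ?_⟩
  have := hc (mem_filter.2 ⟨mem_range.2 (show e - 1 < e by omega), hb⟩)
  simp only [mem_filter, mem_range] at this
  omega

theorem sum_listLen : ∑ b ∈ range N.n, N.listLen b N.M = N.M := by
  have := card_eq_sum_card_fiberwise (s := range N.M) (t := range N.n) (f := N.tl)
    fun h hh => mem_coe.2 (mem_range.2 (N.tl_lt h (mem_range.1 (mem_coe.1 hh))))
  rw [card_range] at this
  exact this.symm

/-- Every node pays one unit for leaving the queue and one for each half-edge of its list. The lists
of the sending copies contain each half-edge once, and so do those of the receiving copies. The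
summand for the current list, which stands outside the sum, vanishes at `e = 0`. -/
theorem searchWork_le (pr ord : ℕ → ℕ) (z : ℕ) :
    N.searchWork pr ord 0 0 z ≤ 2 * N.n + 2 * N.M := by
  have h1 : ∑ y ∈ range (2 * N.n), (N.listLen (N.base y) N.M + 1) = 2 * N.n + 2 * N.M := by
    rw [sum_add_distrib, two_mul, sum_range_add]
    rw [sum_congr rfl fun y hy => by rw [base_left (mem_range.1 hy)]]
    simp only [base_right, sum_listLen]
    simp
    omega
  simp only [searchWork, listLen, range_zero, filter_empty, card_empty, add_zero]
  exact (sum_le_sum_of_subset (filter_subset _ _)).trans h1.le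

variable {d : ℕ} {r x pr ord Q : ℕ → ℕ} {qh qt e z : ℕ}

namespace Searching

/-- `ord` inverts `Q`, so the entries of the queue are distinct nodes. -/
theorem qt_le (h : N.Searching d r x pr ord Q qh qt e z) : qt ≤ 2 * N.n := by
  have := card_le_card_of_injOn (s := range qt) (t := range (2 * N.n)) Q
    (fun i hi => mem_coe.2 (mem_range.2 (h.queue i (mem_range.1 (mem_coe.1 hi))).1))
    (fun i hi j hj hij => by
      rw [← (h.queue i (mem_range.1 (mem_coe.1 hi))).2.2, hij,
        (h.queue j (mem_range.1 (mem_coe.1 hj))).2.2])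
  simpa using this

theorem le_of_marked (h : N.Searching d r x pr ord Q qh qt e z) {y : ℕ} (hy : y < 2 * N.n) :
    pr y ≤ N.M + 1 := by
  by_cases hp : pr y = 0
  · omega
  by_cases c : y < N.n
  · rcases h.left y c hp with a | ⟨k, hk, a, -⟩ <;> omega
  · obtain ⟨v, rfl⟩ : ∃ v, y = N.n + v := ⟨y - N.n, by omega⟩
    obtain ⟨k, hk, a, -⟩ := h.right v (by omega) hp
    omega

/-- With `e = 0` nothing lies in the unscanned part, and with `qh = qt` every marked node has been
scanned: the exceptions in both closure conditions disappear. -/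
theorem marked (h : N.Searching d r x pr ord Q qt qt 0 z) : N.Marked d r x pr ord where
  ord_lt y hy hp := (h.ord_lt y hy hp).1.trans_le h.qt_le
  roots := h.roots
  right := h.right
  left := h.left
  closed k hk hp := by
    have := N.tl_lt k hk
    simpa using h.closed k hk hp (h.ord_lt _ (by omega) hp).1
  closed' k hk hp hx := by
    have := N.tl_lt k hk
    simpa using h.closed' k hk hp (h.ord_lt _ (by omega) hp).1 hx

theorem dequeue (h : N.Searching d r x pr ord Q qh qt 0 z) (hq : qh < qt) :
    N.Searching d r x pr ord Q (qh + 1) qt (N.hh (N.base (Q qh))) (Q qh) := by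
  obtain ⟨h1, h2, h3⟩ := h.queue qh hq
  refine { h with closed := ?_, closed' := ?_, current := ?_, qh_le := hq }
  · intro k hk hp ho
    have := N.tl_lt k hk
    by_cases c : ord (N.tl k) = qh
    · right
      have e1 := (h.ord_lt _ (by omega) hp).2
      rw [c] at e1
      rw [e1, base_left this]
      exact ⟨rfl, N.lt_hh k hk⟩
    · left
      simpa using h.closed k hk hp (by omega)
  · intro k hk hp ho hx
    have := N.tl_lt k hk
    by_cases c : ord (N.n + N.tl k) = qh
    · right
      have e1 := (h.ord_lt _ (by omega) hp).2
      rw [c] at e1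
      rw [e1, base_right]
      exact ⟨rfl, N.lt_hh k hk⟩
    · left
      simpa using h.closed' k hk hp (by omega) hx
  · intro he
    exact ⟨h1, h2, by omega, N.hh_le _ (base_lt h1), N.tl_hh _ (base_lt h1) he⟩

theorem advance_left (h : N.Searching d r x pr ord Q qh qt e z) (he : e ≠ 0) (hz : z < N.n)
    (hp : pr (N.n + N.hd (e - 1)) ≠ 0) :
    N.Searching d r x pr ord Q qh qt (N.nx (e - 1)) z := by
  obtain ⟨h1, h2, h3, h4, h5⟩ := h.current he
  rw [base_left hz] at h5
  have hM : e - 1 < N.M := by omega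
  refine { h with closed := ?_, closed' := ?_, current := ?_ }
  · intro k hk hp' ho
    rcases h.closed k hk hp' ho with c | ⟨c, hke⟩
    · exact .inl c
    · by_cases hke' : k = e - 1
      · exact .inl (hke' ▸ hp)
      · exact .inr ⟨c, N.lt_nx _ hM k (by omega) (by rw [h5, c])⟩
  · intro k hk hp' ho hx
    rcases h.closed' k hk hp' ho hx with c | ⟨c, hke⟩
    · exact .inl c
    · omega
  · intro h0
    have := N.nx_le _ hM
    exact ⟨h1, h2, h3, by omega, by rw [N.tl_nx _ hM h0, h5, base_left hz]⟩

theorem advance_right (h : N.Searching d r x pr ord Q qh qt e z) (he : e ≠ 0) (hz : ¬ z < N.n)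
    (hp : d ≤ x (N.tw (e - 1)) → pr (N.hd (e - 1)) ≠ 0) :
    N.Searching d r x pr ord Q qh qt (N.nx (e - 1)) z := by
  obtain ⟨h1, h2, h3, h4, h5⟩ := h.current he
  obtain ⟨v, rfl⟩ : ∃ v, z = N.n + v := ⟨z - N.n, by omega⟩
  rw [base_right] at h5
  have hM : e - 1 < N.M := by omega
  refine { h with closed := ?_, closed' := ?_, current := ?_ }
  · intro k hk hp' ho
    have := N.tl_lt k hk
    rcases h.closed k hk hp' ho with c | ⟨c, hke⟩
    · exact .inl c
    · omega
  · intro k hk hp' ho hx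
    rcases h.closed' k hk hp' ho hx with c | ⟨c, hke⟩
    · exact .inl c
    · by_cases hke' : k = e - 1
      · subst hke'
        exact .inl (hp hx)
      · exact .inr ⟨c, N.lt_nx _ hM k (by omega) (by omega)⟩
  · intro h0
    have := N.nx_le _ hM
    exact ⟨h1, h2, h3, by omega, by rw [N.tl_nx _ hM h0, h5, base_right]⟩

/-- The new node gets position `qt`. As `qh ≤ qt`, closure demands nothing of it yet, and its
parent, being in the queue already, has smaller rank. -/
theorem mark (h : N.Searching d r x pr ord Q qh qt e z) {t k : ℕ} (ht : t < 2 * N.n)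
    (hp : pr t = 0) (hk : k < N.M)
    (hpar : t = N.n + N.hd k ∧ pr (N.tl k) ≠ 0 ∨
      t = N.hd k ∧ d ≤ x (N.tw k) ∧ pr (N.n + N.tl k) ≠ 0) :
    N.Searching d r x (Function.update pr t (k + 2)) (Function.update ord t qt)
      (Function.update Q qt t) qh (qt + 1) e z := by
  have hm : ∀ y, pr y ≠ 0 → Function.update pr t (k + 2) y ≠ 0 := by
    intro y hy
    rw [Function.update_apply]; split_ifs <;> simp [hy]
  have ho : ∀ y, pr y ≠ 0 → Function.update ord t qt y = ord y := by
    intro y hy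
    rw [Function.update_of_ne]; rintro rfl; exact hy hp
  have hq := h.qh_le
  have htl := N.tl_lt k hk
  constructor
  · intro y hy hy0
    by_cases c : y = t
    · subst c; simp
    · rw [Function.update_of_ne c] at hy0 ⊢
      have := h.ord_lt y hy hy0
      refine ⟨by omega, ?_⟩
      rw [Function.update_of_ne (by omega)]; exact this.2
  · intro i hi
    by_cases c : i = qt
    · subst c; simp [ht]
    · rw [Function.update_of_ne c]
      have := h.queue i (by omega)
      exact ⟨this.1, hm _ this.2.1, by rw [ho _ this.2.1]; exact this.2.2⟩
  · exact fun u hu hr => hm _ (h.roots u hu hr)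
  · intro v hv hv0
    by_cases c : N.n + v = t
    · rcases hpar with ⟨h1, h2⟩ | ⟨h1, h2⟩
      · refine ⟨k, hk, by rw [c, Function.update_self], by omega, hm _ h2, ?_⟩
        rw [ho _ h2, c, Function.update_self]
        exact (h.ord_lt _ (by omega) h2).1
      · have := N.hd_lt k hk
        omega
    · rw [Function.update_of_ne c] at hv0 ⊢
      obtain ⟨k', hk', a1, a2, a3, a4⟩ := h.right v hv hv0
      refine ⟨k', hk', a1, a2, hm _ a3, ?_⟩
      rw [ho _ a3, ho _ hv0]; exact a4
  · intro u hu hu0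
    by_cases c : u = t
    · rcases hpar with ⟨h1, h2⟩ | ⟨h1, h2, h3⟩
      · omega
      · refine .inr ⟨k, hk, by rw [c, Function.update_self], by omega, h2, hm _ h3, ?_⟩
        rw [ho _ h3, c, Function.update_self]
        exact (h.ord_lt _ (by omega) h3).1
    · rw [Function.update_of_ne c] at hu0 ⊢
      rcases h.left u hu hu0 with a | ⟨k', hk', a1, a2, a3, a4, a5⟩
      · exact .inl a
      · refine .inr ⟨k', hk', a1, a2, a3, hm _ a4, ?_⟩
        rw [ho _ a4, ho _ hu0]; exact a5
  · intro k' hk' h1 h2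
    by_cases c : N.tl k' = t
    · rw [c, Function.update_self] at h2; omega
    · rw [Function.update_of_ne c] at h1 h2
      exact (h.closed k' hk' h1 h2).imp (hm _) id
  · intro k' hk' h1 h2 h3
    by_cases c : N.n + N.tl k' = t
    · rw [c, Function.update_self] at h2; omega
    · rw [Function.update_of_ne c] at h1 h2
      exact (h.closed' k' hk' h1 h2 h3).imp (hm _) id
  · intro he
    obtain ⟨h1, h2, h3, h4⟩ := h.current he
    exact ⟨h1, hm _ h2, by rw [ho _ h2]; exact h3, h4⟩
  · omega

/-- The node leaves the sum with its list length plus one; at most its list length comes back as the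
current list. -/
theorem work_dequeue (h : N.Searching d r x pr ord Q qh qt 0 z) (hq : qh < qt) :
    N.searchWork pr ord (qh + 1) (N.hh (N.base (Q qh))) (Q qh) < N.searchWork pr ord qh 0 z := by
  obtain ⟨h1, h2, h3⟩ := h.queue qh hq
  have hmem : Q qh ∈ (range (2 * N.n)).filter (fun y => ¬ (pr y ≠ 0 ∧ ord y < qh)) := by
    simp only [mem_filter, mem_range]
    exact ⟨h1, fun hc => by omega⟩
  have hsub : (range (2 * N.n)).filter (fun y => ¬ (pr y ≠ 0 ∧ ord y < qh + 1)) ⊆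
      ((range (2 * N.n)).filter (fun y => ¬ (pr y ≠ 0 ∧ ord y < qh))).erase (Q qh) := by
    intro y hy
    simp only [mem_erase, mem_filter, mem_range] at hy ⊢
    refine ⟨?_, hy.1, fun hc => hy.2 ⟨hc.1, by omega⟩⟩
    rintro rfl
    exact hy.2 ⟨h2, by omega⟩
  have a1 := sum_le_sum_of_subset (f := fun y => N.listLen (N.base y) N.M + 1) hsub
  have a2 := sum_erase_add _ (fun y => N.listLen (N.base y) N.M + 1) hmem
  have a3 := listLen_mono (N := N) (N.base (Q qh)) (N.hh_le _ (base_lt h1))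
  simp only [searchWork]
  omega

theorem work_advance (h : N.Searching d r x pr ord Q qh qt e z) (he : e ≠ 0) :
    N.searchWork pr ord qh (N.nx (e - 1)) z < N.searchWork pr ord qh e z := by
  obtain ⟨h1, h2, h3, h4, h5⟩ := h.current he
  have := N.nx_le (e - 1) (by omega)
  exact Nat.add_lt_add_left (listLen_lt (by omega) h5) _

/-- The node was counted as unmarked and is still counted as unscanned, since `qh ≤ qt`. -/
theorem work_mark (h : N.Searching d r x pr ord Q qh qt e z) {t k : ℕ} (hp : pr t = 0) :
    N.searchWork (Function.update pr t (k + 2)) (Function.update ord t qt) qh e z =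
      N.searchWork pr ord qh e z := by
  have hq := h.qh_le
  simp only [searchWork]
  congr 2
  ext y
  simp only [mem_filter, and_congr_right_iff]
  intro _
  by_cases c : y = t
  · subst c
    simp [hp, hq]
  · simp [Function.update_of_ne c]

end Searching

/-- Without an end of an augmenting path, the marked nodes form an approximate cut. -/
theorem Marked.rest_le (h : N.Marked (d + 1) r x pr ord) {p q : ℕ} {sl : ℕ → ℕ}
    (hF : N.Feasible p q r sl x) (hs : ∀ v < N.n, pr (N.n + v) ≠ 0 → sl v < d + 1) :
    N.rest r + q * N.wt (N.nb ((range N.n).filter fun u => pr u ≠ 0)) ≤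
      p * N.wt ((range N.n).filter fun u => pr u ≠ 0) + (2 * N.n + N.M) * d := by
  have hnb : ∀ v ∈ N.nb ((range N.n).filter fun u => pr u ≠ 0), pr (N.n + v) ≠ 0 := by
    intro v hv
    obtain ⟨k, hk, h1, rfl⟩ := mem_nb.1 hv
    exact h.closed k hk (mem_filter.1 h1).2
  refine hF.rest_le (filter_subset _ _) ?_ ?_ ?_
  · intro u hu hu'
    by_contra hc
    exact hu' (mem_filter.2 ⟨mem_range.2 hu, h.roots u hu (by omega)⟩)
  · intro v hv
    have := hs v (mem_range.1 (nb_subset _ hv)) (hnb v hv)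
    omega
  · intro k hk h1 h2
    by_contra hc
    apply h1
    -- If more than `d` flowed along `k`, it could be sent back from the marked receiving copy of
    -- its head, and this would mark its tail.
    have := h.closed' (N.tw k) (N.tw_lt k hk) (by rw [N.tl_tw k hk]; exact hnb _ h2)
      (by rw [N.tw_tw k hk]; omega)
    rw [N.hd_tw k hk] at this
    exact mem_filter.2 ⟨mem_range.2 (N.tl_lt k hk), this⟩

theorem Marked.le (h : N.Marked d r x pr ord) {y : ℕ} (hy : y < 2 * N.n) : pr y ≤ N.M + 1 := by
  by_cases hp : pr y = 0
  · omega
  by_cases c : y < N.n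
  · rcases h.left y c hp with a | ⟨k, hk, a, -⟩ <;> omega
  · obtain ⟨v, rfl⟩ : ∃ v, y = N.n + v := ⟨y - N.n, by omega⟩
    obtain ⟨k, hk, a, -⟩ := h.right v (by omega) hp
    omega

/-- One inclusion is closure; for the other, the parent of a marked receiving copy is a marked
sending copy. Thus `w(Γ(S))` can be read off the marks without visiting edges. -/
theorem Marked.nb_eq (h : N.Marked d r x pr ord) :
    N.nb ((range N.n).filter fun u => pr u ≠ 0) = (range N.n).filter fun v => pr (N.n + v) ≠ 0 := by
  ext v
  rw [mem_nb, mem_filter, mem_range]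
  constructor
  · rintro ⟨k, hk, h1, rfl⟩
    exact ⟨N.hd_lt k hk, h.closed k hk (mem_filter.1 h1).2⟩
  · rintro ⟨hv, hp⟩
    obtain ⟨k, hk, -, h2, h3, -⟩ := h.right v hv hp
    exact ⟨k, hk, mem_filter.2 ⟨mem_range.2 (N.tl_lt k hk), h3⟩, h2⟩

/-- The queue after the starting nodes below `i` have been marked. -/
def Rooted (N : Net) (d : ℕ) (r pr Q : ℕ → ℕ) (qt i : ℕ) : Prop :=
  (∀ y < 2 * N.n, pr y = if y < i ∧ d ≤ r y then 1 else 0) ∧ qt ≤ i ∧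
    ∃ ord : ℕ → ℕ, (∀ y < 2 * N.n, pr y ≠ 0 → ord y < qt ∧ Q (ord y) = y) ∧
      ∀ i < qt, Q i < 2 * N.n ∧ pr (Q i) ≠ 0 ∧ ord (Q i) = i

theorem Rooted.zero (d : ℕ) (r : ℕ → ℕ) {pr : ℕ → ℕ} (Q : ℕ → ℕ) (h : ∀ y < 2 * N.n, pr y = 0) :
    N.Rooted d r pr Q 0 0 :=
  ⟨by simpa using h, le_rfl, fun _ => 0, fun y hy h0 => absurd (h y hy) h0, by simp⟩

theorem Rooted.skip {i : ℕ} (h : N.Rooted d r pr Q qt i) (hr : r i < d) :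
    N.Rooted d r pr Q qt (i + 1) := by
  obtain ⟨h1, h2, h3⟩ := h
  refine ⟨fun y hy => ?_, by omega, h3⟩
  rw [h1 y hy]
  refine if_congr ⟨fun a => ⟨by omega, a.2⟩, fun a => ⟨?_, a.2⟩⟩ rfl rfl
  by_contra hc
  have : y = i := by omega
  subst this
  omega

theorem Rooted.mark {i : ℕ} (h : N.Rooted d r pr Q qt i) (hi : i < N.n) (hr : d ≤ r i) :
    N.Rooted d r (Function.update pr i 1) (Function.update Q qt i) (qt + 1) (i + 1) := by
  obtain ⟨h1, h2, ord, h3, h4⟩ := h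
  have hi0 : pr i = 0 := by rw [h1 i (by omega), if_neg (by omega)]
  refine ⟨fun y hy => ?_, by omega, Function.update ord i qt, ?_, ?_⟩
  · by_cases c : y = i
    · subst c; simp [hr]
    · rw [Function.update_of_ne c, h1 y hy]
      exact if_congr ⟨fun a => ⟨by omega, a.2⟩, fun a => ⟨by omega, a.2⟩⟩ rfl rfl
  · intro y hy hy0
    by_cases c : y = i
    · subst c; simp
    · rw [Function.update_of_ne c] at hy0 ⊢
      have := h3 y hy hy0
      exact ⟨by omega, by rw [Function.update_of_ne (by omega)]; exact this.2⟩
  · intro j hj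
    by_cases c : j = qt
    · subst c; simp; omega
    · rw [Function.update_of_ne c]
      obtain ⟨a1, a2, a3⟩ := h4 j (by omega)
      have : Q j ≠ i := fun hc => a2 (hc ▸ hi0)
      rw [Function.update_of_ne this, Function.update_of_ne this]
      exact ⟨a1, a2, a3⟩

theorem Rooted.searching (h : N.Rooted d r pr Q qt N.n) (x : ℕ → ℕ) (z : ℕ) :
    ∃ ord, N.Searching d r x pr ord Q 0 qt 0 z := by
  obtain ⟨h1, h2, ord, h3, h4⟩ := h
  refine ⟨ord, ⟨h3, h4, ?_, ?_, ?_, by simp, by simp, by simp, Nat.zero_le _⟩⟩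
  · intro u hu hr
    rw [h1 u (by omega), if_pos ⟨hu, hr⟩]; exact one_ne_zero
  · intro v hv hp
    rw [h1 _ (by omega), if_neg (by omega)] at hp; exact absurd rfl hp
  · intro u hu hp
    rw [h1 _ (by omega)] at hp ⊢
    left
    by_cases c : u < N.n ∧ d ≤ r u
    · exact ⟨if_pos c, c.2⟩
    · rw [if_neg c] at hp; exact absurd rfl hp

/-- The flow while a path is augmented by `d` from its end, up to the receiving copy of `v`. -/
structure Pending (N : Net) (d p q : ℕ) (r sl x pr ord : ℕ → ℕ) (v : ℕ) : Prop where
  lt : v < N.n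
  marked : pr (N.n + v) ≠ 0
  out : ∀ u < N.n, r u + N.outflow x u = p * N.w u
  inn : ∀ y < N.n, sl y + N.inflow x y + (if y = v then d else 0) = q * N.w y
  -- Flow that can be taken back is only required at nodes of smaller rank, the part of the path
  -- that lies ahead. The term with `d` in `inn` is what the receiving copy of `v` is still owed.
  left : ∀ u < N.n, pr u ≠ 0 → ord u < ord (N.n + v) → ∀ k < N.M, pr u = k + 2 → d ≤ x (N.tw k)

theorem Marked.pending (h : N.Marked d r x pr ord) {p q v : ℕ} {sl : ℕ → ℕ}
    (hF : N.Feasible p q r sl x) (hv : v < N.n) (hp : pr (N.n + v) ≠ 0) (hd : d ≤ sl v) :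
    N.Pending d p q r (Function.update sl v (sl v - d)) x pr ord v where
  lt := hv
  marked := hp
  out := hF.out
  inn y hy := by
    rw [← hF.inn y hy]
    by_cases c : y = v
    · subst c; simp; omega
    · simp [c]
  left u hu hu0 _ k hk hpr := by
    rcases h.left u hu hu0 with a | ⟨k', -, a1, -, a3, -⟩
    · omega
    · have : k' = k := by omega
      exact this ▸ a3

namespace Pending

variable {p q v : ℕ} {sl y : ℕ → ℕ}

theorem parent_lt (h : N.Pending d p q r sl y pr ord v) (hm : N.Marked d r x pr ord) :
    2 ≤ pr (N.n + v) ∧ pr (N.n + v) - 2 < N.M ∧ N.hd (pr (N.n + v) - 2) = v ∧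
      pr (N.tl (pr (N.n + v) - 2)) ≠ 0 ∧ ord (N.tl (pr (N.n + v) - 2)) < ord (N.n + v) := by
  obtain ⟨k, hk, h1, h2, h3, h4⟩ := hm.right v h.lt h.marked
  have : pr (N.n + v) - 2 = k := by omega
  rw [this]
  exact ⟨by omega, hk, h2, h3, h4⟩

/-- The start of the path is reached. -/
theorem finish (h : N.Pending d p q r sl y pr ord v) (hm : N.Marked d r x pr ord) {k u : ℕ}
    (hk : pr (N.n + v) - 2 = k) (hu : N.tl k = u) (h1 : pr u = 1) :
    N.Feasible p q (Function.update r u (r u - d)) sl (Function.update y k (y k + d)) ∧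
      N.rest (Function.update r u (r u - d)) + d = N.rest r := by
  obtain ⟨-, a1, a2, a3, a4⟩ := h.parent_lt hm
  rw [hk] at a1 a2
  have hun : u < N.n := hu ▸ N.tl_lt k a1
  have hd : d ≤ r u := by
    rcases hm.left u hun (by omega) with c | ⟨k', -, c, -⟩
    · exact c.2
    · omega
  refine ⟨⟨fun b hb => ?_, fun b hb => ?_⟩, ?_⟩
  · rw [outflow_add a1, ← h.out b hb, hu]
    by_cases c : b = u
    · subst c; simp; omega
    · simp [c, Ne.symm c]
  · rw [inflow_add a1, ← h.inn b hb, a2]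
    simp [add_assoc, eq_comm]
  · have hmem := mem_range.2 hun
    rw [rest, rest, ← sum_erase_add _ _ hmem, ← sum_erase_add _ r hmem, Function.update_self,
      sum_congr rfl fun k hk => by rw [Function.update_of_ne (ne_of_mem_erase hk)], add_assoc,
      Nat.sub_add_cancel hd]

/-- One step towards the start of the path. -/
theorem step (h : N.Pending d p q r sl y pr ord v) (hm : N.Marked d r x pr ord) {k u k' : ℕ}
    (hk : pr (N.n + v) - 2 = k) (hu : N.tl k = u) (h1 : pr u ≠ 1) (hk' : pr u - 2 = k')
    {y' : ℕ → ℕ} (hy' : y' = Function.update y k (y k + d)) :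
    2 ≤ pr u ∧ k' < N.M ∧ d ≤ y' (N.tw k') ∧ ord (N.n + N.tl k') < ord (N.n + v) ∧
    N.Pending d p q r sl (Function.update y' (N.tw k') (y' (N.tw k') - d)) pr ord (N.tl k') := by
  obtain ⟨-, a1, a2, a3, a4⟩ := h.parent_lt hm
  rw [hk] at a1 a2 a3 a4
  rw [hu] at a3 a4
  have hun : u < N.n := hu ▸ N.tl_lt k a1
  obtain ⟨j, hj, b1, b2, -, b4, b5⟩ : ∃ h < N.M, pr u = h + 2 ∧ N.hd h = u ∧ d ≤ x (N.tw h) ∧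
      pr (N.n + N.tl h) ≠ 0 ∧ ord (N.n + N.tl h) < ord u := by
    rcases hm.left u hun a3 with c | c
    · exact absurd c.1 h1
    · exact c
  obtain rfl : j = k' := by omega
  -- The case `N.tw j = k` need not be excluded: adding `d` there preserves the lower bounds.
  have hle : ∀ i, y i ≤ y' i := by
    intro i
    rw [hy', Function.update_apply]
    split_ifs with c
    · subst c; omega
    · exact le_rfl
  have hd : d ≤ y' (N.tw j) := (h.left u hun a3 a4 j hj b1).trans (hle _)
  refine ⟨by omega, hj, hd, by omega, N.tl_lt j hj, b4, fun b hb => ?_, fun b hb => ?_, ?_⟩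
  · have e1 := outflow_sub (N.tw_lt j hj) hd b
    have e2 := outflow_add (x := y) a1 d b
    rw [← hy'] at e2
    rw [N.tl_tw j hj, b2] at e1
    rw [hu] at e2
    have := h.out b hb
    omega
  · have e1 := inflow_sub (N.tw_lt j hj) hd b
    have e2 := inflow_add (x := y) a1 d b
    rw [← hy'] at e2
    rw [N.hd_tw j hj] at e1
    rw [a2] at e2
    have := h.inn b hb
    simp only [eq_comm (a := b)] at this ⊢
    omega
  · intro u' hu' c1 c2 i hi c3
    -- Taking back flow on `N.tw j` does not spoil the path ahead: a node `u'` reached through the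
    -- same half-edge would be `u`, whose rank is too large.
    have hne : N.tw i ≠ N.tw j := by
      intro hc
      have : i = j := by rw [← N.tw_tw i hi, hc, N.tw_tw j hj]
      subst this
      rcases hm.left u' hu' c1 with c | ⟨i', -, c4, c5, -⟩
      · omega
      · have : i' = i := by omega
        subst this
        have : u' = u := by omega
        subst this
        omega
    rw [Function.update_of_ne hne]
    exact (h.left u' hu' c1 (by omega) i hi c3).trans (hle _)

end Pending

end Net

-- The search as a program

infixl:65 " +ₑ " => WordRAM.Expr.op WordRAM.Op.add
infixl:65 " -ₑ " => WordRAM.Expr.op WordRAM.Op.sub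
infixl:70 " *ₑ " => WordRAM.Expr.op WordRAM.Op.mul
infixl:70 " /ₑ " => WordRAM.Expr.op WordRAM.Op.div
infix:50 " <ₑ " => WordRAM.Expr.op WordRAM.Op.lt
infix:50 " =ₑ " => WordRAM.Expr.op WordRAM.Op.eq
infix:40 " ≔ " => WordRAM.Cmd.assign
infixr:30 " ;; " => WordRAM.Cmd.seq

namespace WordRAM

/-! Memory layout. Variables: `0` the number of vertices, `1` of edges, `2` of half-edges; `3` the
total weight; `4 / 5` the current ratio; `6` whether to continue; `7` the scaling parameter; `8` one
plus the end of an augmenting path, or `0`; `9` the counter of loops; `10`, `11` the ends of the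
queue; `12`, `13` the position of the search; the others are temporary. Arrays: `0`, `1` the
endpoints of the edges; `2` the weights; `3` to `7` the fields `tl`, `hd`, `tw`, `nx`, `hh` of the
network; `8`, `9`, `10` unsent supply, unused capacity and flow; `11` the marks; `12` the queue. -/

/-- One round of a search: examine the next half-edge, or take the next node from the queue. -/
def scanStep : Cmd :=
  .ite (.var 12)
    (16 ≔ .var 12 -ₑ .const 1 ;;
      .ite (.var 13 <ₑ .var 0)
        (15 ≔ .var 0 +ₑ .get 4 (.var 16))
        (.ite (.get 10 (.get 5 (.var 16)) <ₑ .var 7)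
          -- When too little flow can be taken back, the target is set to the current node, which is
          -- marked already, so that nothing gets marked.
          (15 ≔ .var 13)
          (15 ≔ .get 4 (.var 16))) ;;
      .ite (.get 11 (.var 15)) .skip
        (.store 11 (.var 15) (.var 16 +ₑ .const 2) ;;
          .store 12 (.var 11) (.var 15) ;;
          11 ≔ .var 11 +ₑ .const 1) ;;
      12 ≔ .get 6 (.var 16))
    (13 ≔ .get 12 (.var 10) ;;
      10 ≔ .var 10 +ₑ .const 1 ;;
      .ite (.var 13 <ₑ .var 0)
        (12 ≔ .get 7 (.var 13))
        (12 ≔ .get 7 (.var 13 -ₑ .var 0)))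

/-- Unmark all nodes. -/
def clearMarks : Cmd :=
  .for 9 (.var 0 +ₑ .var 0) (.store 11 (.var 9) (.const 0))

/-- Mark and enqueue the vertices whose unsent supply is at least the scaling parameter. -/
def markRoots : Cmd :=
  11 ≔ .const 0 ;;
  .for 9 (.var 0)
    (.ite (.get 8 (.var 9) <ₑ .var 7) .skip
      (.store 11 (.var 9) (.const 1) ;;
        .store 12 (.var 11) (.var 9) ;;
        11 ≔ .var 11 +ₑ .const 1))

/-- Mark the nodes reachable in the residual network of capacities at least the scaling
parameter. -/
def scan : Cmd :=
  10 ≔ .const 0 ;;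
  12 ≔ .const 0 ;;
  -- The sum acts as a disjunction: a list is unfinished or the queue is not exhausted.
  .loop (.var 12 +ₑ (.var 11 -ₑ .var 10)) scanStep

/-- Mark the nodes reachable from the vertices with unsent supply in the residual network of
capacities at least the scaling parameter. -/
def search : Cmd := clearMarks ;; markRoots ;; scan

end WordRAM

open WordRAM

namespace Net

/-- The memory holds the network. -/
structure Loaded (N : Net) (s : State) : Prop where
  n : s.var 0 = N.n
  M : s.var 2 = N.M
  w : s.arr 2 = N.w
  tl : s.arr 3 = N.tl
  hd : s.arr 4 = N.hd
  tw : s.arr 5 = N.tw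
  nx : s.arr 6 = N.nx
  hh : s.arr 7 = N.hh

variable {N : Net}

theorem Loaded.frame {s s' : State} {c : Cmd} (h : N.Loaded s) (hF : Frame c s s')
    (hv : ∀ x ∈ [0, 2], c.writesVar x = false := by decide)
    (ha : ∀ a ∈ [2, 3, 4, 5, 6, 7], c.writesArr a = false := by decide) : N.Loaded s' where
  n := (hF.var 0 (hv 0 (by simp))).trans h.n
  M := (hF.var 2 (hv 2 (by simp))).trans h.M
  w := (hF.arr 2 (ha 2 (by simp))).trans h.w
  tl := (hF.arr 3 (ha 3 (by simp))).trans h.tl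
  hd := (hF.arr 4 (ha 4 (by simp))).trans h.hd
  tw := (hF.arr 5 (ha 5 (by simp))).trans h.tw
  nx := (hF.arr 6 (ha 6 (by simp))).trans h.nx
  hh := (hF.arr 7 (ha 7 (by simp))).trans h.hh

variable {W : ℕ}

theorem Loaded.eval_n {s : State} (h : N.Loaded s) (hW : N.n ≤ W) :
    (Expr.var 0).eval s = N.n ∧ (Expr.var 0).Fits W s := by
  simp only [Expr.eval, Expr.Fits, h.n, hW, and_self]

theorem Loaded.eval_M {s : State} (h : N.Loaded s) (hW : N.M ≤ W) :
    (Expr.var 2).eval s = N.M ∧ (Expr.var 2).Fits W s := by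
  simp only [Expr.eval, Expr.Fits, h.M, hW, and_self]

theorem runs_scanStep {s : State} (hL : N.Loaded s) (hW : 2 * N.n + N.M + 4 ≤ W)
    (hx : ∀ h < N.M, s.arr 10 h ≤ W) (hd : s.var 7 ≤ W) {r ord : ℕ → ℕ}
    (h : N.Searching (s.var 7) r (s.arr 10) (s.arr 11) ord (s.arr 12) (s.var 10) (s.var 11)
      (s.var 12) (s.var 13))
    (hc : s.var 12 + (s.var 11 - s.var 10) ≠ 0) :
    Runs W scanStep 52 s fun s' => ∃ ord',
      N.Searching (s.var 7) r (s.arr 10) (s'.arr 11) ord' (s'.arr 12) (s'.var 10) (s'.var 11)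
        (s'.var 12) (s'.var 13) ∧
      N.searchWork (s'.arr 11) ord' (s'.var 10) (s'.var 12) (s'.var 13) <
        N.searchWork (s.arr 11) ord (s.var 10) (s.var 12) (s.var 13) := by
  refine Runs.of_wp ?_
  have hqt := h.qt_le
  have hqh := h.qh_le
  have h1W : ∀ p [Decidable p], (if p then 1 else 0) ≤ W := by
    intro p _; split_ifs <;> omega
  simp only [scanStep, wp, Expr.eval, Expr.Fits, Op.apply, State.setVar_var, State.setVar_arr,
    State.setArr_var, State.setArr_arr, hL.n, hL.hd, hL.tw, hL.nx, hL.hh, reduceIte,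
    Nat.reduceEqDiff, h1W, ne_eq, ite_eq_right_iff, one_ne_zero, imp_false, not_not]
  generalize s.var 7 = d at *
  generalize s.var 10 = qh at *
  generalize s.var 11 = qt at *
  generalize s.var 12 = e at *
  generalize s.var 13 = z at *
  generalize s.arr 10 = x at *
  generalize s.arr 11 = pr at *
  generalize s.arr 12 = Q at *
  by_cases he : e = 0
  · subst he
    have hq : qh < qt := by omega
    obtain ⟨h1, h2, -⟩ := h.queue qh hq
    have hh := N.hh_le _ (base_lt h1)
    have hb := base_lt h1
    have hD := h.dequeue hq
    have hWk := h.work_dequeue hq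
    refine ⟨by omega, fun hc => absurd rfl hc, fun _ => ⟨⟨by omega, by omega⟩, by omega, ⟨by omega, by omega, trivial⟩, ?_, ?_⟩⟩
    · intro hz
      rw [base, if_pos hz] at hh hD hWk
      exact ⟨by omega, ord, hD, hWk⟩
    · intro hz
      rw [base, if_neg hz] at hh hD hWk
      exact ⟨by omega, ord, hD, hWk⟩
  · obtain ⟨h1, h2, h3, h4, h5⟩ := h.current he
    have hM : e - 1 < N.M := by omega
    have hnx := N.nx_le _ hM
    have hhd := N.hd_lt _ hM
    have htl := N.tl_lt _ hM
    refine ⟨by omega, fun _ => ⟨by omega, ⟨by omega, by omega, trivial⟩, fun hz => ?_, fun hz => ?_⟩,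
      fun hc => absurd hc he⟩
    · rw [base_left hz] at h5
      refine ⟨by omega, ⟨by omega, (h.le_of_marked (by omega)).trans (by omega)⟩, fun hp => ?_,
        fun hp => ?_⟩
      · exact ⟨by omega, ord, h.advance_left he hz hp, h.work_advance he⟩
      · refine ⟨by omega, by omega, by omega, by omega, by omega, by omega, _,
          (h.mark (by omega) hp hM (.inl ⟨rfl, by rw [h5]; exact h2⟩)).advance_left he hz
            (by simp), ?_⟩
        rw [← h.work_mark hp (k := e - 1)]
        exact (h.mark (by omega) hp hM (.inl ⟨rfl, by rw [h5]; exact h2⟩)).work_advance he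
    · have htw := N.tw_lt _ hM
      refine ⟨⟨⟨by omega, hx _ htw⟩, hd, trivial⟩, ?_, ?_⟩
      · intro hlt
        exact ⟨by omega, ⟨by omega, (h.le_of_marked (by omega)).trans (by omega)⟩,
          fun _ => ⟨by omega, ord, h.advance_right he hz fun hle => absurd hlt (by omega),
            h.work_advance he⟩, fun hc => absurd hc h2⟩
      · intro hle
        have h6 : pr (N.n + N.tl (e - 1)) ≠ 0 := by
          rw [h5, base, if_neg hz, Nat.add_sub_cancel' (by omega)]; exact h2
        refine ⟨by omega, ⟨by omega, (h.le_of_marked (by omega)).trans (by omega)⟩,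
          fun hp => ?_, fun hp => ?_⟩
        · exact ⟨by omega, ord, h.advance_right he hz fun _ => hp, h.work_advance he⟩
        · refine ⟨by omega, by omega, by omega, by omega, by omega, by omega, _,
            (h.mark (by omega) hp hM (.inr ⟨rfl, by omega, h6⟩)).advance_right he hz
              (by simp), ?_⟩
          rw [← h.work_mark hp (k := e - 1)]
          exact (h.mark (by omega) hp hM (.inr ⟨rfl, by omega, h6⟩)).work_advance he

theorem runs_clearMarks {s : State} (hL : N.Loaded s) (hW : 2 * N.n + N.M + 4 ≤ W) :
    Runs W clearMarks ((2 * N.n + 1) * 15) s fun s' => ∀ y < 2 * N.n, s'.arr 11 y = 0 := by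
  refine Runs.forLoop 3 (fun j s' => ∀ y < j, s'.arr 11 y = 0) (Nat.mul_le_mul_left _ (by decide))
    rfl (by omega) ?_ (by simp) ?_
  · intro s' hF
    simp only [Expr.eval, Expr.Fits, Op.apply, (hL.frame hF).n]
    omega
  · intro j s' hF hj hv h
    refine Runs.of_wp (c := .store 11 (.var 9) (.const 0)) ?_
    simp only [wp, Expr.eval, Expr.Fits, hv, State.setVar_arr, State.setArr_arr, reduceIte]
    refine ⟨by omega, by omega, fun y hy => ?_⟩
    rw [Function.update_apply]
    split_ifs with c
    · rfl
    · exact h y (by omega)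

theorem runs_markRoots {s : State} (hL : N.Loaded s) (hW : 2 * N.n + N.M + 4 ≤ W)
    (hr : ∀ u < N.n, s.arr 8 u ≤ W) (hd : s.var 7 ≤ W) (h0 : ∀ y < 2 * N.n, s.arr 11 y = 0) :
    Runs W markRoots (2 + (N.n + 1) * 26) s fun s' =>
      N.Rooted (s.var 7) (s.arr 8) (s'.arr 11) (s'.arr 12) (s'.var 11) N.n := by
  have h1W : ∀ p [Decidable p], (if p then 1 else 0) ≤ W := by
    intro p _; split_ifs <;> omega
  refine Runs.seq' (Q₁ := fun s' => s'.var 11 = 0)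
    (Runs.of_wp (c := 11 ≔ .const 0) (by simp [wp, Expr.eval, Expr.Fits])) fun s₁ F₁ h₁ => ?_
  have hL₁ := hL.frame F₁
  have e8 := F₁.arr 8 rfl
  have e7 := F₁.var 7 rfl
  have e11 := F₁.arr 11 rfl
  refine Runs.forLoop 16 (fun j s' => N.Rooted (s.var 7) (s.arr 8) (s'.arr 11) (s'.arr 12)
    (s'.var 11) j) (Nat.mul_le_mul_left _ (by decide)) rfl (by omega) ?_ ?_ ?_
  · exact fun s' hF => (hL₁.frame hF).eval_n (by omega)
  · simp only [State.setVar_arr, State.setVar_var, Nat.reduceEqDiff, reduceIte, h₁, e11]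
    exact Rooted.zero _ _ _ h0
  · intro j s' hF hj hv h
    have hqt := h.2.1
    have f8 := (hF.arr 8 rfl).trans e8
    have f7 := (hF.var 7 rfl).trans e7
    refine Runs.of_wp (c := .ite _ _ _) ?_
    simp only [wp, Expr.eval, Expr.Fits, Op.apply, State.setVar_var, State.setVar_arr,
      State.setArr_var, State.setArr_arr, hv, f8, f7, reduceIte, Nat.reduceEqDiff, h1W, ne_eq,
      ite_eq_right_iff, one_ne_zero, imp_false, not_not]
    refine ⟨⟨⟨by omega, hr j hj⟩, hd, trivial⟩, h.skip, fun hc => ?_⟩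
    exact ⟨by omega, by omega, by omega, by omega, by omega, h.mark hj (not_lt.1 hc)⟩

theorem runs_scan {s : State} (hL : N.Loaded s) (hW : 2 * N.n + N.M + 4 ≤ W)
    (hx : ∀ h < N.M, s.arr 10 h ≤ W) (hd : s.var 7 ≤ W)
    (h : N.Rooted (s.var 7) (s.arr 8) (s.arr 11) (s.arr 12) (s.var 11) N.n) :
    Runs W scan (4 + (2 * N.n + 2 * N.M + 1) * 60) s fun s' =>
      ∃ ord, N.Marked (s.var 7) (s.arr 8) (s.arr 10) (s'.arr 11) ord := by
  refine (Runs.seq' (T₁ := 2) (T₂ := 2 + (2 * N.n + 2 * N.M + 1) * 60)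
    (Q₁ := fun s' => s'.var 10 = 0)
    (Runs.of_wp (c := 10 ≔ .const 0) (by simp [wp, Expr.eval, Expr.Fits])) fun s₁ F₁ h₁ =>
    Runs.seq' (T₁ := 2) (Q₁ := fun s' => s'.var 12 = 0)
    (Runs.of_wp (c := 12 ≔ .const 0) (by simp [wp, Expr.eval, Expr.Fits])) fun s₂ F₂ h₂ => ?_).mono
      (by omega) fun s' _ h => h
  have hL₂ := (hL.frame F₁).frame F₂
  have e7 := (F₂.var 7 rfl).trans (F₁.var 7 rfl)
  have e10 := (F₂.arr 10 rfl).trans (F₁.arr 10 rfl)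
  have e11 := (F₂.arr 11 rfl).trans (F₁.arr 11 rfl)
  have e12 := (F₂.arr 12 rfl).trans (F₁.arr 12 rfl)
  have e11' := (F₂.var 11 rfl).trans (F₁.var 11 rfl)
  have e10' := (F₂.var 10 rfl).trans h₁
  have hloop := Runs.loop (W := W) (e := .var 12 +ₑ (.var 11 -ₑ .var 10)) (c := scanStep)
    (B := 52) (k := 2 * N.n + 2 * N.M) (s := s₂)
    (fun k s' => ∃ ord, N.Searching (s.var 7) (s.arr 8) (s.arr 10) (s'.arr 11) ord (s'.arr 12)
        (s'.var 10) (s'.var 11) (s'.var 12) (s'.var 13) ∧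
      N.searchWork (s'.arr 11) ord (s'.var 10) (s'.var 12) (s'.var 13) ≤ k) ?_ ?_
  · refine hloop.mono (Nat.mul_le_mul_left _ (by decide)) ?_
    rintro s' - ⟨k, ⟨ord, h3, -⟩, h4⟩
    have hq := h3.qh_le
    simp only [Expr.eval, Op.apply] at h4
    have h5 : s'.var 12 = 0 := by omega
    have h6 : s'.var 10 = s'.var 11 := by omega
    rw [h5, h6] at h3
    exact ⟨ord, h3.marked⟩
  · obtain ⟨ord, h3⟩ := h.searching (s.arr 10) (s₂.var 13)
    rw [e11, e12, e11', e10', h₂]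
    exact ⟨ord, h3, searchWork_le _ _ _⟩
  · rintro k s' hF ⟨ord, h3, h4⟩
    have f7 := (hF.var 7 rfl).trans e7
    have f10 := (hF.arr 10 rfl).trans e10
    have hq := h3.qh_le
    have hqt := h3.qt_le
    have hc := h3.current
    refine ⟨?_, fun he => ?_⟩
    · simp only [Expr.eval, Expr.Fits, Op.apply]
      have : s'.var 12 ≤ N.M := by
        by_cases he : s'.var 12 = 0
        · omega
        · exact (hc he).2.2.2.1
      omega
    · refine (runs_scanStep (hL₂.frame hF) hW (by rwa [f10]) (by rwa [f7]) (r := s.arr 8)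
        (ord := ord) (by rw [f7, f10]; exact h3) he).mono le_rfl ?_
      rintro s'' - ⟨ord', h5, h6⟩
      rw [f7, f10] at h5
      exact ⟨_, h6.trans_le h4, ord', h5, le_rfl⟩

theorem runs_search {s : State} (hL : N.Loaded s) (hW : 2 * N.n + N.M + 4 ≤ W)
    (hx : ∀ h < N.M, s.arr 10 h ≤ W) (hr : ∀ u < N.n, s.arr 8 u ≤ W) (hd : s.var 7 ≤ W) :
    Runs W search (200 * (N.n + N.M + 1)) s fun s' =>
      ∃ ord, N.Marked (s.var 7) (s.arr 8) (s.arr 10) (s'.arr 11) ord := by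
  refine (Runs.seq' (runs_clearMarks hL hW) fun s₁ F₁ h₁ => ?_).mono
    (T := (2 * N.n + 1) * 15 + ((2 + (N.n + 1) * 26) + (4 + (2 * N.n + 2 * N.M + 1) * 60)))
    (by omega) fun s' _ h => h
  rw [← F₁.arr 8 rfl, ← F₁.var 7 rfl] at *
  refine Runs.seq' (runs_markRoots (hL.frame F₁) hW hr hd h₁) fun s₂ F₂ h₂ => ?_
  rw [← F₂.arr 8 rfl, ← F₂.var 7 rfl, ← F₁.arr 10 rfl, ← F₂.arr 10 rfl] at *
  exact runs_scan ((hL.frame F₁).frame F₂) hW hx hd h₂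

end Net

/-! ### Augmentation and capacity scaling -/

namespace WordRAM

/-- Find a marked node from which at least the scaling parameter can be sent on to the sink. -/
def findSink : Cmd :=
  8 ≔ .const 0 ;;
  .for 9 (.var 0)
    (.ite (.get 11 (.var 0 +ₑ .var 9))
      (.ite (.get 9 (.var 9) <ₑ .var 7) .skip (8 ≔ .var 9 +ₑ .const 1))
      .skip)

/-- Follow the path of an augmentation backwards through two half-edges. -/
def traceStep : Cmd :=
  16 ≔ .get 11 (.var 0 +ₑ .var 17) -ₑ .const 2 ;;
  .store 10 (.var 16) (.get 10 (.var 16) +ₑ .var 7) ;;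
  21 ≔ .get 3 (.var 16) ;;
  .ite (.get 11 (.var 21) =ₑ .const 1)
    (.store 8 (.var 21) (.get 8 (.var 21) -ₑ .var 7) ;;
      18 ≔ .const 0)
    (16 ≔ .get 11 (.var 21) -ₑ .const 2 ;;
      19 ≔ .get 5 (.var 16) ;;
      .store 10 (.var 19) (.get 10 (.var 19) -ₑ .var 7) ;;
      17 ≔ .get 3 (.var 16))

/-- Augment the flow along the path that ends where `findSink` has found. -/
def augment : Cmd :=
  (17 ≔ .var 8 -ₑ .const 1 ;;
    .store 9 (.var 17) (.get 9 (.var 17) -ₑ .var 7) ;;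
    18 ≔ .const 1) ;;
  .loop (.var 18) traceStep

/-- Search and augment until no augmenting path is left. -/
def phase : Cmd :=
  8 ≔ .const 1 ;;
  .loop (.var 8) (search ;; findSink ;; .ite (.var 8) augment .skip)

/-- Make the flow maximal by phases in which the scaling parameter is halved. -/
def scaling : Cmd :=
  .loop (.var 7) (phase ;; 7 ≔ .var 7 /ₑ .const 2)

end WordRAM

namespace Net

variable {N : Net} {W K p q : ℕ}

theorem Feasible.le_r {r sl x : ℕ → ℕ} (h : N.Feasible p q r sl x)
    (hp : ∀ u < N.n, p * N.w u ≤ K) : ∀ u < N.n, r u ≤ K := fun u hu =>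
  (Nat.le_add_right _ _).trans ((h.out u hu).trans_le (hp u hu))

theorem Feasible.le_sl {r sl x : ℕ → ℕ} (h : N.Feasible p q r sl x)
    (hq : ∀ u < N.n, q * N.w u ≤ K) : ∀ u < N.n, sl u ≤ K := fun u hu =>
  (Nat.le_add_right _ _).trans ((h.inn u hu).trans_le (hq u hu))

theorem Feasible.le_x {r sl x : ℕ → ℕ} (h : N.Feasible p q r sl x)
    (hq : ∀ u < N.n, q * N.w u ≤ K) : ∀ k < N.M, x k ≤ K := fun k hk => by
  have h1 := h.inn _ (N.hd_lt k hk)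
  have h2 := hq _ (N.hd_lt k hk)
  have h3 := le_inflow (x := x) hk
  omega

theorem runs_findSink {s : State} (hL : N.Loaded s) (hW : 2 * N.n + N.M + 4 ≤ W)
    (hp : ∀ y < 2 * N.n, s.arr 11 y ≤ W) (hs : ∀ v < N.n, s.arr 9 v ≤ W) (hd : s.var 7 ≤ W) :
    Runs W findSink (2 + (N.n + 1) * 24) s fun s' =>
      (s'.var 8 = 0 → ∀ v < N.n, s.arr 11 (N.n + v) ≠ 0 → s.arr 9 v < s.var 7) ∧
      (s'.var 8 ≠ 0 → s'.var 8 ≤ N.n ∧ s.arr 11 (N.n + (s'.var 8 - 1)) ≠ 0 ∧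
        s.var 7 ≤ s.arr 9 (s'.var 8 - 1)) := by
  have h1W : ∀ p [Decidable p], (if p then 1 else 0) ≤ W := by
    intro p _; split_ifs <;> omega
  refine Runs.seq' (Q₁ := fun s' => s'.var 8 = 0)
    (Runs.of_wp (c := 8 ≔ .const 0) (by simp [wp, Expr.eval, Expr.Fits])) fun s₁ F₁ h₁ => ?_
  have hL₁ := hL.frame F₁
  refine Runs.forLoop 14 (fun j s' =>
      (s'.var 8 = 0 → ∀ v < j, s.arr 11 (N.n + v) ≠ 0 → s.arr 9 v < s.var 7) ∧
      (s'.var 8 ≠ 0 → s'.var 8 ≤ N.n ∧ s.arr 11 (N.n + (s'.var 8 - 1)) ≠ 0 ∧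
        s.var 7 ≤ s.arr 9 (s'.var 8 - 1))) (Nat.mul_le_mul_left _ (by decide)) rfl (by omega)
    (fun s' hF => (hL₁.frame hF).eval_n (by omega)) (by simp [h₁]) ?_
  intro j s' hF hj hv h
  have f11 := (hF.arr 11 rfl).trans (F₁.arr 11 rfl)
  have f9 := (hF.arr 9 rfl).trans (F₁.arr 9 rfl)
  have f7 := (hF.var 7 rfl).trans (F₁.var 7 rfl)
  refine Runs.of_wp (c := .ite _ _ _) ?_
  simp only [wp, Expr.eval, Expr.Fits, Op.apply, State.setVar_var,
    hv, f11, f9, f7, (hL₁.frame hF).n, reduceIte, Nat.reduceEqDiff, h1W, ne_eq,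
    ite_eq_right_iff, one_ne_zero, imp_false, not_not]
  refine ⟨⟨by omega, hp _ (by omega)⟩, fun hm => ⟨⟨⟨by omega, hs j hj⟩, hd, trivial⟩, fun hlt =>
    ⟨fun h0 v hv hm' => ?_, h.2⟩, fun hle => ⟨by omega, fun h0 => h0.elim, fun _ => ?_⟩⟩,
    fun hm => ⟨fun h0 v hv hm' => ?_, h.2⟩⟩
  · rcases Nat.lt_succ_iff_lt_or_eq.1 hv with c | c
    · exact h.1 h0 v c hm'
    · exact c ▸ hlt
  · exact ⟨hj, by simpa using hm, by simpa using hle⟩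
  · rcases Nat.lt_succ_iff_lt_or_eq.1 hv with c | c
    · exact h.1 h0 v c hm'
    · exact absurd (c ▸ hm) hm'

/-- The flow `x` is the one for which the marks were made; the flow in memory has changed along the
path since then. Adding `d ≤ K` to a flow value of at most `K` is why words up to `2 * K` are
needed. -/
theorem runs_traceStep {s : State} (hL : N.Loaded s) (hW : 2 * N.n + N.M + 4 + 2 * K ≤ W)
    (hp : ∀ u < N.n, p * N.w u ≤ K) (hq : ∀ u < N.n, q * N.w u ≤ K) (hd : s.var 7 ≤ K)
    {x ord : ℕ → ℕ} (hm : N.Marked (s.var 7) (s.arr 8) x (s.arr 11) ord)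
    (h : N.Pending (s.var 7) p q (s.arr 8) (s.arr 9) (s.arr 10) (s.arr 11) ord (s.var 17)) :
    Runs W traceStep 47 s fun s' =>
      (s'.var 18 = 0 ∧ N.Feasible p q (s'.arr 8) (s.arr 9) (s'.arr 10) ∧
        N.rest (s'.arr 8) + s.var 7 = N.rest (s.arr 8)) ∨
      (s'.var 18 = s.var 18 ∧ s'.arr 8 = s.arr 8 ∧
        N.Pending (s.var 7) p q (s.arr 8) (s.arr 9) (s'.arr 10) (s.arr 11) ord (s'.var 17) ∧
        ord (N.n + s'.var 17) < ord (N.n + s.var 17)) := by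
  have h1W : ∀ p [Decidable p], (if p then 1 else 0) ≤ W := by
    intro p _; split_ifs <;> omega
  refine Runs.of_wp ?_
  simp only [traceStep, wp, Expr.eval, Expr.Fits, Op.apply, State.setVar_var, State.setVar_arr,
    State.setArr_var, State.setArr_arr, hL.n, hL.tl, hL.tw, reduceIte,
    Nat.reduceEqDiff, h1W, ne_eq, ite_eq_right_iff, one_ne_zero, imp_false, not_not]
  have hle := fun y => hm.le (y := y)
  have hfin := fun k u => h.finish hm (k := k) (u := u)
  have hstep := fun k u k' => h.step hm (k := k) (u := u) (k' := k')
  have hpar := h.parent_lt hm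
  have hv := h.lt
  have hr : ∀ u < N.n, s.arr 8 u ≤ K := fun u hu =>
    (Nat.le_add_right _ _).trans ((h.out u hu).trans_le (hp u hu))
  have hx : ∀ k < N.M, s.arr 10 k ≤ K := fun k hk => by
    have h1 := h.inn _ (N.hd_lt k hk)
    have h2 := hq _ (N.hd_lt k hk)
    have h3 := le_inflow (x := s.arr 10) hk
    omega
  clear h hm
  generalize s.var 7 = d at *
  generalize s.var 17 = v at *
  generalize s.arr 8 = r at *
  generalize s.arr 10 = x at *
  generalize s.arr 11 = pr at *
  obtain ⟨b1, b2, b3, b4, b5⟩ := hpar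
  have hpv := hle (N.n + v) (by omega)
  generalize hk : pr (N.n + v) - 2 = k at *
  have hu := N.tl_lt k b2
  have hxk := hx k b2
  generalize hu' : N.tl k = u at *
  have hpu := hle u (by omega)
  have hru := hr u hu
  refine ⟨by omega, by omega, by omega, by omega, ⟨⟨by omega, by omega⟩, by omega, trivial⟩,
    fun h1 => ⟨by omega, by omega, by omega, ?_⟩, fun h1 => ?_⟩
  · exact .inl ⟨trivial, hfin k u rfl hu' h1⟩
  · generalize hk' : pr u - 2 = k' at *
    obtain ⟨c1, c2, c3, c4, c5⟩ := hstep k u k' rfl hu' h1 hk' rfl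
    have c6 := N.tw_lt k' c2
    have c7 := N.tl_lt k' c2
    have c8 : Function.update x k (x k + d) (N.tw k') ≤ W := by
      have := hx _ c6
      rw [Function.update_apply]
      split_ifs <;> omega
    exact ⟨by omega, by omega, by omega, by omega, by omega,
      .inr ⟨trivial, trivial, c5, c4⟩⟩

theorem runs_augment {s : State} (hL : N.Loaded s) (hW : 2 * N.n + N.M + 4 + 2 * K ≤ W)
    (hp : ∀ u < N.n, p * N.w u ≤ K) (hq : ∀ u < N.n, q * N.w u ≤ K) (hd : s.var 7 ≤ K)
    {ord : ℕ → ℕ} (hm : N.Marked (s.var 7) (s.arr 8) (s.arr 10) (s.arr 11) ord)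
    (h : N.Feasible p q (s.arr 8) (s.arr 9) (s.arr 10)) (h8 : s.var 8 ≠ 0) (hn : s.var 8 ≤ N.n)
    (h11 : s.arr 11 (N.n + (s.var 8 - 1)) ≠ 0) (h9 : s.var 7 ≤ s.arr 9 (s.var 8 - 1)) :
    Runs W augment (12 + (2 * N.n + 1) * 49) s fun s' =>
      N.Feasible p q (s'.arr 8) (s'.arr 9) (s'.arr 10) ∧
        N.rest (s'.arr 8) + s.var 7 = N.rest (s.arr 8) := by
  have hsl : s.arr 9 (s.var 8 - 1) ≤ W := by
    have := h.inn (s.var 8 - 1) (by omega)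
    have := hq (s.var 8 - 1) (by omega)
    omega
  refine Runs.seq' (T₁ := 12) (T₂ := (2 * N.n + 1) * 49) (Q₁ := fun s' => s'.var 18 = 1 ∧
    N.Pending (s.var 7) p q (s.arr 8) (s'.arr 9) (s.arr 10) (s.arr 11) ord (s'.var 17))
    (Runs.of_wp ?_) fun s₁ F₁ h₁ => ?_
  · simp only [wp, Expr.eval, Expr.Fits, Op.apply, State.setVar_var, State.setVar_arr,
      State.setArr_var, State.setArr_arr, reduceIte, Nat.reduceEqDiff]
    exact ⟨by omega, by omega, by omega, by omega, trivial,
      hm.pending h (by omega) h11 h9⟩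
  · have hL₁ := hL.frame F₁
    have e7 := F₁.var 7 rfl
    have e8 := F₁.arr 8 rfl
    have e10 := F₁.arr 10 rfl
    have e11 := F₁.arr 11 rfl
    -- The rank of the receiving copy reached so far decreases in every round and is below `2 * N.n`
    -- at the start.
    have hloop := Runs.loop (W := W) (e := .var 18) (c := traceStep) (B := 47) (k := 2 * N.n)
      (s := s₁) (fun k s' => (s'.var 18 = 0 ∧ N.Feasible p q (s'.arr 8) (s₁.arr 9) (s'.arr 10) ∧
        N.rest (s'.arr 8) + s.var 7 = N.rest (s.arr 8)) ∨
      (s'.var 18 = 1 ∧ s'.arr 8 = s.arr 8 ∧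
        N.Pending (s.var 7) p q (s.arr 8) (s₁.arr 9) (s'.arr 10) (s.arr 11) ord (s'.var 17) ∧
        ord (N.n + s'.var 17) < k)) ?_ ?_
    · refine hloop.mono (Nat.mul_le_mul_left _ (by decide)) ?_
      rintro s' hF ⟨k, hI, h0⟩
      simp only [Expr.eval] at h0
      rcases hI with hI | hI
      · rw [← hF.arr 9 rfl] at hI
        exact hI.2
      · omega
    · right
      refine ⟨h₁.1, e8, by rw [e10]; exact h₁.2, hm.ord_lt _ ?_ h₁.2.marked⟩
      have := h₁.2.lt
      omega
    · rintro k s' hF (⟨h2, -⟩ | ⟨h2, h3, h4, h5⟩)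
      · simp [Expr.Fits, Expr.eval, h2]
      · refine ⟨by simp only [Expr.Fits]; omega, fun _ => ?_⟩
        have f7 := (hF.var 7 rfl).trans e7
        have f9 := hF.arr 9 rfl
        have f11 := (hF.arr 11 rfl).trans e11
        refine (runs_traceStep (hL₁.frame hF) hW hp hq (by omega) (x := s.arr 10) (ord := ord)
          (by rw [f7, h3, f11]; exact hm) (by rw [f7, h3, f9, f11]; exact h4)).mono le_rfl ?_
        rw [f7, h3, f9, f11, h2]
        rintro s'' - (h6 | ⟨h6, h7, h8, h9⟩)
        · exact ⟨k - 1, by omega, .inl h6⟩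
        · exact ⟨ord (N.n + s'.var 17), by omega, .inr ⟨h6, h7, h8, h9⟩⟩

/-- The flow in memory has no augmenting path of capacity `d`, and the marks show this. -/
def Saturated (N : Net) (d : ℕ) (s : State) : Prop :=
  (∃ ord, N.Marked d (s.arr 8) (s.arr 10) (s.arr 11) ord) ∧
    ∀ v < N.n, s.arr 11 (N.n + v) ≠ 0 → s.arr 9 v < d

theorem runs_phaseStep {s : State} (hL : N.Loaded s) (hW : 2 * N.n + N.M + 4 + 2 * K ≤ W)
    (hp : ∀ u < N.n, p * N.w u ≤ K) (hq : ∀ u < N.n, q * N.w u ≤ K) (hd : s.var 7 ≤ K)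
    (h : N.Feasible p q (s.arr 8) (s.arr 9) (s.arr 10)) :
    Runs W (search ;; findSink ;; .ite (.var 8) augment .skip) (330 * (N.n + N.M + 1)) s fun s' =>
      s'.var 8 ≤ W ∧ N.Feasible p q (s'.arr 8) (s'.arr 9) (s'.arr 10) ∧
        (s'.var 8 = 0 ∧ N.Saturated (s.var 7) s' ∨
          s'.var 8 ≠ 0 ∧ N.rest (s'.arr 8) + s.var 7 = N.rest (s.arr 8)) := by
  have hr := h.le_r hp
  have hsl := h.le_sl hq
  have hx := h.le_x hq
  refine (Runs.seq' (runs_search hL (by omega) (fun k hk => (hx k hk).trans (by omega))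
    (fun k hk => (hr k hk).trans (by omega)) (by omega)) fun s₁ F₁ h₁ => ?_).mono
    (T := 200 * (N.n + N.M + 1) + ((2 + (N.n + 1) * 24) + (2 + (12 + (2 * N.n + 1) * 49))))
    (by omega) fun s' _ h => h
  obtain ⟨ord, hm⟩ := h₁
  have hL₁ := hL.frame F₁
  have e7 := F₁.var 7 rfl
  have e8 := F₁.arr 8 rfl
  have e9 := F₁.arr 9 rfl
  have e10 := F₁.arr 10 rfl
  refine Runs.seq' (runs_findSink hL₁ (by omega) (fun y hy => (hm.le hy).trans (by omega))
    (fun v hv => by rw [e9]; exact (hsl v hv).trans (by omega)) (by omega)) fun s₂ F₂ h₂ => ?_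
  have hL₂ := hL₁.frame F₂
  rw [e7, e9] at h₂
  have f7 := (F₂.var 7 rfl).trans e7
  have f8 := (F₂.arr 8 rfl).trans e8
  have f9 := (F₂.arr 9 rfl).trans e9
  have f10 := (F₂.arr 10 rfl).trans e10
  have f11 := F₂.arr 11 rfl
  rw [← f11] at hm h₂
  have h8W : s₂.var 8 ≤ W := by
    by_cases c : s₂.var 8 = 0
    · omega
    · have := (h₂.2 c).1
      omega
  refine Runs.ite h8W (fun h8 => ?_) fun h8 => Runs.of_wp (c := .skip) ?_ ?_
  · obtain ⟨a1, a2, a3⟩ := h₂.2 h8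
    refine (runs_augment hL₂ hW hp hq (by omega) (ord := ord) (by rw [f7, f8, f10]; exact hm)
      (by rw [f8, f9, f10]; exact h) h8 a1 a2 (by rw [f7, f9]; exact a3)).mono le_rfl ?_
    rintro s₃ F₃ ⟨h3, h4⟩
    rw [f7, f8] at h4
    rw [F₃.var 8 rfl]
    exact ⟨h8W, h3, .inr ⟨h8, h4⟩⟩
  · rw [wp, Saturated, f8, f9, f10]
    exact ⟨h8W, h, .inl ⟨h8, ⟨ord, hm⟩, h₂.1 h8⟩⟩
  · simp only [Cmd.flatCost]; omega

/-- The set `S` is a certificate that the program never computes: the unsent supply exceeds its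
deficiency by at most `j` times the parameter. Every augmentation lowers the supply by the
parameter, and it cannot fall below the deficiency, so at most `j` augmentations occur. -/
theorem runs_phase {s : State} (hL : N.Loaded s) (hW : 2 * N.n + N.M + 4 + 2 * K ≤ W)
    (hp : ∀ u < N.n, p * N.w u ≤ K) (hq : ∀ u < N.n, q * N.w u ≤ K) (hd : s.var 7 ≤ K)
    (h0 : s.var 7 ≠ 0)
    (h : N.Feasible p q (s.arr 8) (s.arr 9) (s.arr 10)) {S : Finset ℕ} (hS : S ⊆ Finset.range N.n)
    {j : ℕ} (hj : N.rest (s.arr 8) + q * N.wt (N.nb S) ≤ p * N.wt S + j * s.var 7) :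
    Runs W phase (2 + (j + 2) * (340 * (N.n + N.M + 1))) s fun s' =>
      N.Feasible p q (s'.arr 8) (s'.arr 9) (s'.arr 10) ∧ N.Saturated (s.var 7) s' := by
  refine Runs.seq' (Q₁ := fun s' => s'.var 8 = 1)
    (Runs.of_wp (c := 8 ≔ .const 1) (by simp [wp, Expr.eval, Expr.Fits]; omega)) fun s₁ F₁ h₁ => ?_
  have hL₁ := hL.frame F₁
  have e7 := F₁.var 7 rfl
  have e8 := F₁.arr 8 rfl
  have e9 := F₁.arr 9 rfl
  have e10 := F₁.arr 10 rfl
  have hloop := Runs.loop (W := W) (e := .var 8)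
    (c := (search ;; findSink ;; .ite (.var 8) augment .skip)) (B := 330 * (N.n + N.M + 1))
    (k := j + 1) (s := s₁)
    (fun k s' => s'.var 8 ≤ W ∧ N.Feasible p q (s'.arr 8) (s'.arr 9) (s'.arr 10) ∧
      (s'.var 8 = 0 ∧ N.Saturated (s.var 7) s' ∨ s'.var 8 ≠ 0 ∧
        ∃ i, i + 1 = k ∧ N.rest (s'.arr 8) + q * N.wt (N.nb S) ≤ p * N.wt S + i * s.var 7)) ?_ ?_
  · refine hloop.mono (Nat.mul_le_mul_left _ (by simp only [Expr.cost]; omega)) ?_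
    rintro s' - ⟨k, ⟨-, a1, a2⟩, a3⟩
    simp only [Expr.eval] at a3
    rcases a2 with a2 | a2
    · exact ⟨a1, a2.2⟩
    · exact absurd a3 a2.1
  · rw [e8, e9, e10]
    exact ⟨by omega, h, .inr ⟨by omega, j, rfl, hj⟩⟩
  · rintro k s' hF ⟨a1, a2, a3⟩
    refine ⟨a1, fun h8 => ?_⟩
    simp only [Expr.eval] at h8
    have f7 := (hF.var 7 rfl).trans e7
    obtain ⟨-, i, hi, a4⟩ := a3.resolve_left fun c => h8 c.1
    refine (runs_phaseStep (hL₁.frame hF) hW hp hq (by omega) a2).mono le_rfl ?_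
    rw [f7]
    rintro s'' - ⟨b1, b2, b3 | ⟨b3, b4⟩⟩
    · exact ⟨0, by omega, b1, b2, .inl b3⟩
    · have b5 := b2.le_rest hS
      obtain ⟨i', rfl⟩ : ∃ i', i = i' + 1 := by
        refine ⟨i - 1, ?_⟩
        rcases Nat.eq_zero_or_pos i with rfl | c
        · omega
        · omega
      rw [add_mul, one_mul] at a4
      exact ⟨i' + 1, by omega, b1, b2, .inr ⟨b3, i', rfl, by omega⟩⟩

theorem runs_scaling {s : State} (hL : N.Loaded s) (hW : 2 * N.n + N.M + 4 + 2 * K ≤ W)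
    (hp : ∀ u < N.n, p * N.w u ≤ K) (hq : ∀ u < N.n, q * N.w u ≤ K) (hd : s.var 7 ≤ K)
    (h0 : s.var 7 ≠ 0) (h : N.Feasible p q (s.arr 8) (s.arr 9) (s.arr 10))
    (hr : N.rest (s.arr 8) ≤ s.var 7) {k : ℕ} (hk : s.var 7 < 2 ^ k) :
    Runs W scaling ((k + 1) * (1000 * (2 * N.n + N.M + 1) ^ 2)) s fun s' =>
      N.Feasible p q (s'.arr 8) (s'.arr 9) (s'.arr 10) ∧ N.Saturated 1 s' := by
  have hloop := Runs.loop (W := W) (e := .var 7) (c := (phase ;; 7 ≔ .var 7 /ₑ .const 2))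
    (B := 900 * (2 * N.n + N.M + 1) ^ 2) (k := k) (s := s)
    (fun k s' => s'.var 7 ≤ K ∧ s'.var 7 < 2 ^ k ∧
      N.Feasible p q (s'.arr 8) (s'.arr 9) (s'.arr 10) ∧ (s'.var 7 = 0 → N.Saturated 1 s') ∧
      ∃ S ⊆ Finset.range N.n, N.rest (s'.arr 8) + q * N.wt (N.nb S) ≤
        p * N.wt S + 2 * (2 * N.n + N.M) * s'.var 7) ?_ ?_
  · refine hloop.mono (Nat.mul_le_mul_left _ ?_) ?_
    · simp only [Expr.cost]
      nlinarith
    · rintro s' - ⟨k, ⟨-, -, a1, a2, -⟩, a3⟩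
      exact ⟨a1, a2 a3⟩
  · refine ⟨hd, hk, h, fun c => absurd c h0, ∅, Finset.empty_subset _, ?_⟩
    have : N.nb ∅ = ∅ := by ext; simp [mem_nb]
    have := N.n_pos
    simp only [‹N.nb ∅ = ∅›, wt, Finset.sum_empty, mul_zero, add_zero, zero_add]
    nlinarith
  · rintro k s' hF ⟨a1, a2, a3, -, S, hS, a5⟩
    have hL' := hL.frame hF
    refine ⟨by simp only [Expr.Fits]; omega, fun h7 => ?_⟩
    simp only [Expr.eval] at h7
    refine (Runs.seq' (T₂ := 4) (runs_phase hL' hW hp hq a1 h7 a3 hS a5) fun s₁ F₁ h₁ =>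
      Runs.of_wp (c := 7 ≔ .var 7 /ₑ .const 2) ?_).mono (T := 2 + (2 * (2 * N.n + N.M) + 2) *
        (340 * (N.n + N.M + 1)) + 4) ?_ fun _ _ h => h
    · have e7 := F₁.var 7 rfl
      obtain ⟨k, rfl⟩ : ∃ k', k = k' + 1 := by
        refine ⟨k - 1, ?_⟩
        rcases Nat.eq_zero_or_pos k with rfl | c
        · rw [pow_zero] at a2; omega
        · omega
      rw [pow_succ] at a2
      obtain ⟨b1, b2⟩ := h₁
      obtain ⟨d, hd⟩ : ∃ d, s'.var 7 = d + 1 := ⟨s'.var 7 - 1, by omega⟩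
      simp only [wp, Expr.eval, Expr.Fits, Op.apply, e7, Saturated, State.setVar_var,
        State.setVar_arr, reduceIte]
      refine ⟨by omega, k, Nat.lt_succ_self k, by omega, by omega, b1, fun c => ?_,
        (Finset.range N.n).filter fun u => s₁.arr 11 u ≠ 0, Finset.filter_subset _ _, ?_⟩
      -- Halving yields `0` only from `1`, and the phase with parameter `1` leaves no augmenting
      -- path at all.
      · have : s'.var 7 = 1 := by omega
        rw [this] at b2
        exact b2
      · rw [hd] at b2
        refine (b2.1.choose_spec.rest_le b1 b2.2).trans (Nat.add_le_add_left ?_ _)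
        -- The old parameter is `d + 1` and the error is `(2n + M) * d`; measured in the halved
        -- parameter this is the factor `2 * (2n + M)` of the invariant.
        have h2 : d ≤ 2 * ((d + 1) / 2) := by omega
        exact (Nat.mul_le_mul_left _ h2).trans_eq (by rw [hd]; ring)
    · have := N.n_pos
      nlinarith [Nat.zero_le N.M, Nat.zero_le (N.n * N.M)]

end Net

/-! ### Newton's iteration on the ratio -/

namespace WordRAM

/-- Start with the zero flow and a large scaling parameter. -/
def initFlow : Cmd :=
  .for 9 (.var 0)
    (.store 8 (.var 9) (.var 4 *ₑ .get 2 (.var 9)) ;;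
      .store 9 (.var 9) (.var 5 *ₑ .get 2 (.var 9))) ;;
  .for 9 (.var 2) (.store 10 (.var 9) (.const 0)) ;;
  7 ≔ .var 4 *ₑ .var 3

/-- Compute the weights of the two sides of the marked set. -/
def readCut : Cmd :=
  (19 ≔ .const 0 ;; 20 ≔ .const 0) ;;
  .for 9 (.var 0)
    (.ite (.get 11 (.var 9)) (20 ≔ .var 20 +ₑ .get 2 (.var 9)) .skip ;;
      .ite (.get 11 (.var 0 +ₑ .var 9)) (19 ≔ .var 19 +ₑ .get 2 (.var 9)) .skip)

/-- Pass to the ratio of the marked set if it is smaller, and stop otherwise. -/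
def improve : Cmd :=
  .ite (.var 19 *ₑ .var 5 <ₑ .var 4 *ₑ .var 20)
    (4 ≔ .var 19 ;; 5 ≔ .var 20)
    (6 ≔ .const 0)

/-- Improve the current ratio until it is minimal. -/
def minimize : Cmd :=
  (4 ≔ .var 3 ;; 5 ≔ .var 3 ;; 6 ≔ .const 1) ;;
  .loop (.var 6) (initFlow ;; scaling ;; readCut ;; improve)

end WordRAM

open Finset

namespace Net

variable {N : Net} {W : ℕ}

theorem w_le {u : ℕ} (hu : u < N.n) : N.w u ≤ N.wt (range N.n) :=
  single_le_sum (f := N.w) (fun _ _ => Nat.zero_le _) (mem_range.2 hu)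

theorem runs_initFlow {s : State} (hL : N.Loaded s)
    (hW : 2 * N.n + N.M + 4 + 2 * (N.wt (range N.n) * N.wt (range N.n)) ≤ W)
    (h3 : s.var 3 = N.wt (range N.n)) (hp : s.var 4 ≤ N.wt (range N.n))
    (hq : s.var 5 ≤ N.wt (range N.n)) :
    Runs W initFlow (40 * (2 * N.n + N.M + 1)) s fun s' =>
      N.Feasible (s.var 4) (s.var 5) (s'.arr 8) (s'.arr 9) (s'.arr 10) ∧
        N.rest (s'.arr 8) ≤ s'.var 7 ∧ s'.var 7 = s.var 4 * N.wt (range N.n) := by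
  have hsq := Nat.le_mul_self (N.wt (range N.n))
  refine (Runs.seq' (T₁ := (N.n + 1) * 24) (Q₁ := fun s' => ∀ u < N.n,
    s'.arr 8 u = s.var 4 * N.w u ∧ s'.arr 9 u = s.var 5 * N.w u) (Runs.forLoop 14
    (fun j s' => ∀ u < j, s'.arr 8 u = s.var 4 * N.w u ∧ s'.arr 9 u = s.var 5 * N.w u)
    (Nat.mul_le_mul_left _ (by decide)) rfl (by omega)
    (fun s' hF => (hL.frame hF).eval_n (by omega)) (by simp) ?_) fun s₁ F₁ h₁ =>
    Runs.seq' (T₁ := (N.M + 1) * 13) (Q₁ := fun s' => ∀ k < N.M, s'.arr 10 k = 0) (Runs.forLoop 3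
    (fun j s' => ∀ k < j, s'.arr 10 k = 0)
    (Nat.mul_le_mul_left _ (by decide)) rfl (by omega)
    (fun s' hF => ((hL.frame F₁).frame hF).eval_M (by omega)) (by simp) ?_) fun s₂ F₂ h₂ =>
    Runs.of_wp (B := 4) ?_).mono (by have := N.n_pos; omega) fun _ _ h => h
  · intro j s' hF hj hv h
    have h1 : s.var 4 * N.w j ≤ N.wt (range N.n) * N.wt (range N.n) := Nat.mul_le_mul hp (w_le hj)
    have h2 : s.var 5 * N.w j ≤ N.wt (range N.n) * N.wt (range N.n) := Nat.mul_le_mul hq (w_le hj)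
    have h3 := w_le hj
    refine Runs.of_wp (c := .seq _ _) ?_
    simp only [wp, Expr.eval, Expr.Fits, Op.apply, State.setVar_arr, State.setArr_var,
      State.setArr_arr, hv, hF.var 4 rfl, hF.var 5 rfl, (hL.frame hF).w, reduceIte,
      Nat.reduceEqDiff]
    refine ⟨by omega, by omega, by omega, by omega, fun u hu => ?_⟩
    rw [Function.update_apply, Function.update_apply]
    split_ifs with c
    · rw [c]; exact ⟨rfl, rfl⟩
    · exact h u (by omega)
  · intro j s' hF hj hv h
    refine Runs.of_wp (c := .store _ _ _) ?_
    simp only [wp, Expr.eval, Expr.Fits, State.setVar_arr, State.setArr_arr, hv, reduceIte]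
    refine ⟨by omega, by omega, fun u hu => ?_⟩
    rw [Function.update_apply]
    split_ifs with c
    · rfl
    · exact h u (by omega)
  · have e4 := (F₂.var 4 rfl).trans (F₁.var 4 rfl)
    have e3 := (F₂.var 3 rfl).trans (F₁.var 3 rfl)
    have hpw : s.var 4 * N.wt (range N.n) ≤ N.wt (range N.n) * N.wt (range N.n) :=
      Nat.mul_le_mul_right _ hp
    simp only [wp, Expr.eval, Expr.Fits, Op.apply, State.setVar_var, State.setVar_arr, e3, e4, h3,
      reduceIte, F₂.arr 8 rfl, F₂.arr 9 rfl]
    refine ⟨by omega, ⟨fun u hu => ?_, fun u hu => ?_⟩, le_of_eq ?_, trivial⟩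
    · rw [(h₁ u hu).1, outflow, sum_eq_zero, add_zero]
      intro k hk
      rw [h₂ k (mem_range.1 hk), ite_self]
    · rw [(h₁ u hu).2, inflow, sum_eq_zero, add_zero]
      intro k hk
      rw [h₂ k (mem_range.1 hk), ite_self]
    · rw [rest, wt, mul_sum]
      exact sum_congr rfl fun u hu => (h₁ u (mem_range.1 hu)).1

theorem wt_filter_range_succ (P : ℕ → Prop) [DecidablePred P] (j : ℕ) :
    N.wt ((range (j + 1)).filter P) = N.wt ((range j).filter P) + if P j then N.w j else 0 := by
  simp only [wt, sum_filter, sum_range_succ]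

theorem runs_readCut {s : State} (hL : N.Loaded s)
    (hW : 2 * N.n + N.M + 4 + N.wt (range N.n) ≤ W) (hm : ∀ y < 2 * N.n, s.arr 11 y ≤ W) :
    Runs W readCut (4 + (N.n + 1) * 29) s fun s' =>
      s'.var 20 = N.wt ((range N.n).filter fun u => s.arr 11 u ≠ 0) ∧
      s'.var 19 = N.wt ((range N.n).filter fun v => s.arr 11 (N.n + v) ≠ 0) := by
  refine Runs.seq' (Q₁ := fun s' => s'.var 19 = 0 ∧ s'.var 20 = 0)
    (Runs.of_wp (c := .seq _ _) (by simp [wp, Expr.eval, Expr.Fits])) fun s₁ F₁ h₁ => ?_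
  have hL₁ := hL.frame F₁
  refine Runs.forLoop 19 (fun j s' =>
      s'.var 20 = N.wt ((range j).filter fun u => s.arr 11 u ≠ 0) ∧
      s'.var 19 = N.wt ((range j).filter fun v => s.arr 11 (N.n + v) ≠ 0))
      (Nat.mul_le_mul_left _ (by decide)) rfl (by omega)
    (fun s' hF => (hL₁.frame hF).eval_n (by omega)) (by simp [h₁, wt]) ?_
  intro j s' hF hj hv ⟨h20, h19⟩
  have f11 := (hF.arr 11 rfl).trans (F₁.arr 11 rfl)
  refine Runs.of_wp (c := .seq _ _) ?_
  have b : ∀ (P : ℕ → Prop) [DecidablePred P],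
      N.wt ((range (j + 1)).filter P) ≤ N.wt (range N.n) := fun P _ =>
    wt_mono ((filter_subset _ _).trans (range_mono hj))
  have b20 := b fun u => s.arr 11 u ≠ 0
  have b19 := b fun v => s.arr 11 (N.n + v) ≠ 0
  rw [wt_filter_range_succ, ← h20] at b20
  rw [wt_filter_range_succ, ← h19] at b19
  have m1 := hm j (by omega)
  have m2 := hm (N.n + j) (by omega)
  simp only [wp, Expr.eval, Expr.Fits, Op.apply, State.setVar_var, State.setVar_arr,
    hv, f11, (hL₁.frame hF).n, (hL₁.frame hF).w, reduceIte, Nat.reduceEqDiff,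
    wt_filter_range_succ, ← h20, ← h19]
  have hw := w_le hj
  refine ⟨⟨by omega, m1⟩, fun c1 => ?_, fun c1 => ?_⟩
  · rw [if_pos c1] at b20 ⊢
    refine ⟨by omega, ⟨by omega, by omega⟩, fun c2 => ?_, fun c2 => ?_⟩
    · rw [if_pos c2] at b19 ⊢
      exact ⟨by omega, rfl, rfl⟩
    · rw [if_neg (not_not.2 c2)]
      exact ⟨rfl, rfl⟩
  · rw [if_neg (not_not.2 c1)]
    refine ⟨⟨by omega, by omega⟩, fun c2 => ?_, fun c2 => ?_⟩
    · rw [if_pos c2] at b19 ⊢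
      exact ⟨by omega, rfl, rfl⟩
    · rw [if_neg (not_not.2 c2)]
      exact ⟨rfl, rfl⟩

/-- The ratio `p / q` is at most the ratio of every vertex set. -/
def IsLower (N : Net) (p q : ℕ) : Prop :=
  ∀ T ⊆ range N.n, p * N.wt T ≤ q * N.wt (N.nb T)

theorem runs_minimizeStep {s : State} (hL : N.Loaded s)
    (hW : 2 * N.n + N.M + 4 + 2 * (N.wt (range N.n) * N.wt (range N.n)) ≤ W)
    (h3 : s.var 3 = N.wt (range N.n)) (hp : s.var 4 ≤ N.wt (range N.n))
    (hq : s.var 5 ≤ N.wt (range N.n)) (hp0 : 0 < s.var 4) {k : ℕ}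
    (hk : N.wt (range N.n) * N.wt (range N.n) < 2 ^ k) :
    Runs W (initFlow ;; scaling ;; readCut ;; improve)
      ((k + 1) * (1100 * (2 * N.n + N.M + 1) ^ 2)) s fun s' =>
      (s'.var 6 = 0 ∧ s'.var 4 = s.var 4 ∧ s'.var 5 = s.var 5 ∧ N.IsLower (s.var 4) (s.var 5)) ∨
      (s'.var 6 = s.var 6 ∧ ∃ T ⊆ range N.n, N.IsMinimizer (s.var 4) (s.var 5) T ∧
        N.wt (N.nb T) * s.var 5 < s.var 4 * N.wt T ∧ s'.var 4 = N.wt (N.nb T) ∧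
        s'.var 5 = N.wt T) := by
  have h1W : ∀ p [Decidable p], (if p then 1 else 0) ≤ W := by
    intro p _; split_ifs <;> omega
  have hV : 0 < N.wt (range N.n) := wt_pos subset_rfl ⟨0, mem_range.2 N.n_pos⟩
  have hsq := Nat.le_mul_self (N.wt (range N.n))
  have hpw : s.var 4 * N.wt (range N.n) ≤ N.wt (range N.n) * N.wt (range N.n) :=
    Nat.mul_le_mul_right _ hp
  have hpu : ∀ u < N.n, s.var 4 * N.w u ≤ N.wt (range N.n) * N.wt (range N.n) :=
    fun u hu => Nat.mul_le_mul hp (w_le hu)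
  have hqu : ∀ u < N.n, s.var 5 * N.w u ≤ N.wt (range N.n) * N.wt (range N.n) :=
    fun u hu => Nat.mul_le_mul hq (w_le hu)
  refine (Runs.seq' (runs_initFlow hL hW h3 hp hq) fun s₁ F₁ ⟨h₁, h₁', h₁''⟩ =>
    Runs.seq' (runs_scaling (hL.frame F₁) hW hpu hqu (by omega)
      (by rw [h₁'']; exact (Nat.mul_pos hp0 hV).ne') h₁ h₁' (k := k) (by omega))
    fun s₂ F₂ ⟨h₂, ⟨ord, hm⟩, hsat⟩ =>
    Runs.seq' (runs_readCut ((hL.frame F₁).frame F₂) (by omega)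
      fun y hy => (hm.le hy).trans (by omega)) fun s₃ F₃ ⟨h₃, h₃'⟩ => Runs.of_wp (B := 12) ?_).mono
      ?_ fun _ _ h => h
  · rw [← hm.nb_eq] at h₃'
    have hS : ((range N.n).filter fun u => s₂.arr 11 u ≠ 0) ⊆ range N.n := filter_subset _ _
    -- Saturation at parameter `1` means error `0`: the unsent supply is at most the deficiency of
    -- the marked set. Comparison with `le_rest` for any `T` makes this set a minimizer, and if its
    -- value is nonnegative, so is that of every `T`.
    have hcut := hm.rest_le (d := 0) h₂ hsat
    generalize ((range N.n).filter fun u => s₂.arr 11 u ≠ 0) = S at *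
    have e4 := (F₃.var 4 rfl).trans ((F₂.var 4 rfl).trans (F₁.var 4 rfl))
    have e5 := (F₃.var 5 rfl).trans ((F₂.var 5 rfl).trans (F₁.var 5 rfl))
    have e6 := (F₃.var 6 rfl).trans ((F₂.var 6 rfl).trans (F₁.var 6 rfl))
    have c1 : N.wt S ≤ N.wt (range N.n) := wt_mono hS
    have c2 : N.wt (N.nb S) ≤ N.wt (range N.n) := wt_mono (nb_subset S)
    have c3 := Nat.mul_le_mul c2 hq
    have c4 := Nat.mul_le_mul hp c1
    simp only [improve, wp, Expr.eval, Expr.Fits, Op.apply, State.setVar_var,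
      h₃, h₃', e4, e5, e6, reduceIte, Nat.reduceEqDiff, h1W, ne_eq, ite_eq_right_iff, one_ne_zero,
      imp_false, not_not]
    refine ⟨⟨by omega, by omega, trivial⟩, fun hlt => ⟨by omega, by omega, .inr ⟨trivial, S, hS,
      fun T hT => ?_, hlt, rfl, rfl⟩⟩, fun hle => ⟨Nat.zero_le _, .inl ⟨trivial, trivial, trivial,
      fun T hT => ?_⟩⟩⟩
    · have := h₂.le_rest hT
      omega
    · have := h₂.le_rest hT
      rw [mul_comm (N.wt (N.nb S))] at hle
      omega
  · have hn := N.n_pos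
    have : (k + 1) * (1000 * (2 * N.n + N.M + 1) ^ 2) + (k + 1) * (100 * (2 * N.n + N.M + 1) ^ 2) =
      (k + 1) * (1100 * (2 * N.n + N.M + 1) ^ 2) := by ring
    have h4 : 1 * (100 * (2 * N.n + N.M + 1) ^ 2) ≤ (k + 1) * (100 * (2 * N.n + N.M + 1) ^ 2) :=
      Nat.mul_le_mul_right _ (by omega)
    have h5 : 2 * N.n + N.M + 1 ≤ (2 * N.n + N.M + 1) ^ 2 := Nat.le_self_pow two_ne_zero _
    omega

/-- The invariant looks ahead: any minimizer that would improve the current ratio is a proper subset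
of the current `S`. For `S = V` this needs no minimality of `S`, and it makes the cardinality of `S`
bound the remaining rounds. -/
theorem runs_minimize {s : State} (hL : N.Loaded s)
    (hW : 2 * N.n + N.M + 4 + 2 * (N.wt (range N.n) * N.wt (range N.n)) ≤ W)
    (h3 : s.var 3 = N.wt (range N.n)) {k : ℕ}
    (hk : N.wt (range N.n) * N.wt (range N.n) < 2 ^ k) :
    Runs W minimize ((N.n + 3) * ((k + 1) * (1200 * (2 * N.n + N.M + 1) ^ 2))) s fun s' =>
      N.IsLower (s'.var 4) (s'.var 5) ∧
        ∃ S ⊆ range N.n, S.Nonempty ∧ s'.var 4 = N.wt (N.nb S) ∧ s'.var 5 = N.wt S := by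
  have hsq := Nat.le_mul_self (N.wt (range N.n))
  refine (Runs.seq' (T₁ := 6) (Q₁ := fun s' => s'.var 4 = N.wt (range N.n) ∧
    s'.var 5 = N.wt (range N.n) ∧ s'.var 6 = 1)
    (Runs.of_wp (c := .seq _ _) ?_) fun s₁ F₁ h₁ => (Runs.loop (W := W)
    (B := (k + 1) * (1100 * (2 * N.n + N.M + 1) ^ 2))
    (k := N.n + 1) (s := s₁) (fun i s' => s'.var 6 ≤ 1 ∧
      (s'.var 6 = 0 → N.IsLower (s'.var 4) (s'.var 5)) ∧
      ∃ S ⊆ range N.n, S.Nonempty ∧ s'.var 4 = N.wt (N.nb S) ∧ s'.var 5 = N.wt S ∧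
        (s'.var 6 = 1 → S.card < i ∧ ∀ T ⊆ range N.n, N.IsMinimizer (s'.var 4) (s'.var 5) T →
          N.wt (N.nb T) * s'.var 5 < s'.var 4 * N.wt T → T ⊂ S)) ?_ ?_).mono le_rfl ?_).mono
          (T := 6 + (N.n + 1 + 1) * (1 + 1 + (k + 1) * (1100 * (2 * N.n + N.M + 1) ^ 2)))
    ?_ fun _ _ h => h
  · simp only [wp, Expr.eval, Expr.Fits, State.setVar_var, h3, reduceIte, Nat.reduceEqDiff,
      and_self, and_true]
    omega
  · obtain ⟨a4, a5, a6⟩ := h₁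
    refine ⟨by omega, by omega, range N.n, subset_rfl, ⟨0, mem_range.2 N.n_pos⟩,
      by rw [nb_range, a4], a5, fun _ => ⟨by simp, fun T hT _ hlt => ?_⟩⟩
    refine ssubset_of_subset_of_ne hT ?_
    rintro rfl
    rw [nb_range, a4, a5] at hlt
    exact lt_irrefl _ hlt
  · rintro i s' hF ⟨a1, a2, S, hS, hS0, a4, a5, a6⟩
    have hL' := (hL.frame F₁).frame hF
    refine ⟨by simp only [Expr.Fits]; omega, fun h6 => ?_⟩
    simp only [Expr.eval] at h6
    have h6 : s'.var 6 = 1 := by omega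
    obtain ⟨hi, hmin⟩ := a6 h6
    refine (runs_minimizeStep hL' hW ((hF.var 3 rfl).trans ((F₁.var 3 rfl).trans h3))
      (a4 ▸ wt_mono (nb_subset S)) (a5 ▸ wt_mono hS)
      (a4 ▸ wt_pos (nb_subset S) (nb_nonempty hS hS0)) hk).mono le_rfl ?_
    rintro s'' F'' (⟨b6, b4, b5, hlow⟩ | ⟨b6, T, hT, hTmin, hlt, b4, b5⟩)
    · exact ⟨i - 1, by omega, by omega, fun _ => by rw [b4, b5]; exact hlow, S, hS, hS0,
        b4.trans a4, b5.trans a5, by omega⟩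
    · have hTS := hmin T hT hTmin hlt
      have hcard := card_lt_card hTS
      have hT0 : T.Nonempty := by
        rw [nonempty_iff_ne_empty]
        rintro rfl
        simp [wt] at hlt
      refine ⟨S.card, hi, by omega, by omega, T, hT, hT0, b4, b5, fun _ => ⟨hcard,
        fun U hU hUmin hU' => ?_⟩⟩
      -- `T` minimizes for the old parameter and `U` for the smaller new one, so `U ⊆ T`. Equality
      -- is impossible because `T` has value `0` at its own ratio.
      refine ssubset_of_subset_of_ne (hTmin.subset hUmin hT hU (by rwa [b4, b5])) ?_
      rintro rfl
      rw [b4, b5] at hU'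
      exact lt_irrefl _ hU'
  · rintro s' - ⟨i, ⟨-, a2, S, hS, hS0, a4, a5, -⟩, a6⟩
    exact ⟨a2 a6, S, hS, hS0, a4, a5⟩
  · have h5 : 1 ≤ (k + 1) * (2 * N.n + N.M + 1) ^ 2 := Nat.mul_pos (by omega) (by positivity)
    have e1 : (k + 1) * (1100 * (2 * N.n + N.M + 1) ^ 2) =
      1100 * ((k + 1) * (2 * N.n + N.M + 1) ^ 2) := by ring
    have e2 : (k + 1) * (1200 * (2 * N.n + N.M + 1) ^ 2) =
      1200 * ((k + 1) * (2 * N.n + N.M + 1) ^ 2) := by ring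
    rw [e1, e2]
    generalize (k + 1) * (2 * N.n + N.M + 1) ^ 2 = X at *
    nlinarith [Nat.mul_le_mul_left N.n h5]

end Net

/-! ### Building the network from the edge list -/

namespace WordRAM

/-- Compute the total weight. -/
def sumWeights : Cmd :=
  3 ≔ .const 0 ;;
  .for 9 (.var 0) (3 ≔ .var 3 +ₑ .get 2 (.var 9))

/-- Insert a half-edge into the list of its tail. -/
def insertStep : Cmd :=
  17 ≔ .var 9 /ₑ .const 2 ;;
  .ite (.var 9 =ₑ .var 17 +ₑ .var 17)
    (.store 3 (.var 9) (.get 0 (.var 17)) ;;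
      .store 4 (.var 9) (.get 1 (.var 17)) ;;
      .store 5 (.var 9) (.var 9 +ₑ .const 1))
    (.store 3 (.var 9) (.get 1 (.var 17)) ;;
      .store 4 (.var 9) (.get 0 (.var 17)) ;;
      .store 5 (.var 9) (.var 9 -ₑ .const 1)) ;;
  17 ≔ .get 3 (.var 9) ;;
  .store 6 (.var 9) (.get 7 (.var 17)) ;;
  .store 7 (.var 17) (.var 9 +ₑ .const 1)

/-- Build the linked lists of half-edges. -/
def build : Cmd :=
  2 ≔ .var 1 +ₑ .var 1 ;;
  .for 9 (.var 2) insertStep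

/-- Compute the minimal ratio of a weighted graph. -/
def minRatioProgram : Cmd :=
  sumWeights ;; build ;; minimize ;; 0 ≔ .var 4 ;; 1 ≔ .var 5

end WordRAM

/-- The tails of the half-edges `2 * i` and `2 * i + 1` that belong to the edge from `a i` to
`b i`. -/
def halfTail (a b : ℕ → ℕ) (h : ℕ) : ℕ := if h % 2 = 0 then a (h / 2) else b (h / 2)

/-- The half-edge opposite to `h`. -/
def twin (h : ℕ) : ℕ := if h % 2 = 0 then h + 1 else h - 1

theorem twin_lt {m h : ℕ} (hh : h < 2 * m) : twin h < 2 * m := by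
  unfold twin; split_ifs <;> omega

theorem twin_twin (h : ℕ) : twin (twin h) = h := by
  unfold twin; split_ifs <;> omega

theorem halfTail_twin (a b : ℕ → ℕ) (h : ℕ) : halfTail a b (twin h) = halfTail b a h := by
  unfold halfTail twin
  split_ifs with h1 h2 h2
  · omega
  · congr 1; omega
  · congr 1; omega
  · omega

/-- Each edge is traversed in both directions. A general `P` serves both the absence of isolated
vertices and, later, adjacency. -/
theorem exists_halfTail {a b : ℕ → ℕ} {m : ℕ} {P : ℕ → ℕ → Prop} :
    (∃ h < 2 * m, P (halfTail a b h) (halfTail b a h)) ↔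
      ∃ i < m, P (a i) (b i) ∨ P (b i) (a i) := by
  constructor
  · rintro ⟨h, hh, hp⟩
    refine ⟨h / 2, by omega, ?_⟩
    unfold halfTail at hp
    split_ifs at hp
    · exact .inl hp
    · exact .inr hp
  · rintro ⟨i, hi, hp | hp⟩
    · refine ⟨2 * i, by omega, ?_⟩
      simpa [halfTail] using hp
    · refine ⟨2 * i + 1, by omega, ?_⟩
      have : (2 * i + 1) / 2 = i := by omega
      simpa [halfTail, this, Nat.add_mod] using hp

/-- The half-edges below `j` are sorted into linked lists according to their tails. -/
structure Linked (tl nx hh : ℕ → ℕ) (j : ℕ) : Prop where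
  lt_hh : ∀ h < j, h < hh (tl h)
  hh_le : ∀ u, hh u ≤ j
  tl_hh : ∀ u, hh u ≠ 0 → tl (hh u - 1) = u
  nx_le : ∀ h < j, nx h ≤ h
  lt_nx : ∀ h < j, ∀ h' < h, tl h' = tl h → h' < nx h
  tl_nx : ∀ h < j, nx h ≠ 0 → tl (nx h - 1) = tl h

/-- All half-edges inserted so far have numbers below `j`, so putting `j` in front of its list keeps
the list decreasing; the old head bounds all earlier half-edges with the same tail. -/
theorem Linked.insert {tl nx hh : ℕ → ℕ} {j : ℕ} (h : Linked tl nx hh j) :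
    Linked tl (Function.update nx j (hh (tl j))) (Function.update hh (tl j) (j + 1)) (j + 1) := by
  constructor
  · intro k hk
    rw [Function.update_apply]
    split_ifs with c
    · exact hk
    · refine h.lt_hh k ?_
      have : k ≠ j := by rintro rfl; exact c rfl
      omega
  · intro u
    rw [Function.update_apply]
    split_ifs
    · exact le_rfl
    · exact (h.hh_le u).trans (Nat.le_succ j)
  · intro u hu
    rw [Function.update_apply] at hu ⊢
    split_ifs at hu ⊢ with c
    · rw [c]; rfl
    · exact h.tl_hh u hu
  · intro k hk
    rw [Function.update_apply]
    split_ifs with c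
    · subst c; exact h.hh_le _
    · exact h.nx_le k (by omega)
  · intro k hk i hi hik
    rw [Function.update_apply]
    split_ifs with c
    · subst c
      rw [← hik]
      exact h.lt_hh i hi
    · exact h.lt_nx k (by omega) i hi hik
  · intro k hk hk0
    rw [Function.update_apply] at hk0 ⊢
    split_ifs at hk0 ⊢ with c
    · rw [c]
      exact h.tl_hh _ hk0
    · exact h.tl_nx k (by omega) hk0

variable {W : ℕ}

theorem runs_sumWeights {s : State} {n : ℕ} (hn : s.var 0 = n)
    (hW : n + 1 + ∑ u ∈ range n, s.arr 2 u ≤ W) :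
    Runs W sumWeights (2 + (n + 1) * 15) s fun s' => s'.var 3 = ∑ u ∈ range n, s.arr 2 u := by
  refine Runs.seq' (Q₁ := fun s' => s'.var 3 = 0)
    (Runs.of_wp (c := 3 ≔ .const 0) (by simp [wp, Expr.eval, Expr.Fits])) fun s₁ F₁ h₁ => ?_
  refine Runs.forLoop 5 (fun j s' => s'.var 3 = ∑ u ∈ range j, s.arr 2 u)
    (Nat.mul_le_mul_left _ (by decide)) rfl (by omega) (fun s' hF => ?_) (by simp [h₁]) ?_
  · have := (hF.var 0 rfl).trans ((F₁.var 0 rfl).trans hn)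
    simp only [Expr.eval, Expr.Fits, this, true_and]
    omega
  · intro j s' hF hj hv h
    have h2 : ∑ u ∈ range (j + 1), s.arr 2 u ≤ ∑ u ∈ range n, s.arr 2 u :=
      sum_le_sum_of_subset (range_mono hj)
    rw [sum_range_succ, ← h] at h2
    refine Runs.of_wp (c := 3 ≔ _) ?_
    simp only [wp, Expr.eval, Expr.Fits, Op.apply, State.setVar_var, hv, reduceIte,
      Nat.reduceEqDiff, (hF.arr 2 rfl).trans (F₁.arr 2 rfl), sum_range_succ, ← h]
    exact ⟨⟨by omega, by omega, by omega⟩, trivial⟩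

theorem runs_build {s : State} {n m : ℕ} (hn : s.var 0 = n) (hm : s.var 1 = m)
    (hW : n + 2 * m + 3 ≤ W) (ha : ∀ i < m, s.arr 0 i < n) (hb : ∀ i < m, s.arr 1 i < n)
    (h7 : ∀ u, s.arr 7 u = 0) (hn0 : 0 < n) (hw : ∀ u < n, 0 < s.arr 2 u)
    (hadj : ∀ u < n, ∃ i < m, s.arr 0 i = u ∨ s.arr 1 i = u) :
    Runs W build (4 + (2 * m + 1) * 60) s fun s' => ∃ N : Net, N.Loaded s' ∧ N.n = n ∧
      N.M = 2 * m ∧ N.w = s.arr 2 ∧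
      ∀ P : ℕ → ℕ → Prop, (∃ h < N.M, P (N.tl h) (N.hd h)) ↔
        ∃ i < m, P (s.arr 0 i) (s.arr 1 i) ∨ P (s.arr 1 i) (s.arr 0 i) := by
  have h1W : ∀ p [Decidable p], (if p then 1 else 0) ≤ W := by
    intro p _; split_ifs <;> omega
  refine Runs.seq' (Q₁ := fun s' => s'.var 2 = 2 * m)
    (Runs.of_wp (c := 2 ≔ .var 1 +ₑ .var 1) ?_) fun s₁ F₁ h₁ => (Runs.forLoop 50
    (fun j s' => (∀ h < j, s'.arr 3 h = halfTail (s.arr 0) (s.arr 1) h ∧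
      s'.arr 4 h = halfTail (s.arr 1) (s.arr 0) h ∧ s'.arr 5 h = twin h) ∧
      Linked (halfTail (s.arr 0) (s.arr 1)) (s'.arr 6) (s'.arr 7) j) (N := 2 * m)
    (Nat.mul_le_mul_left _ (by decide)) rfl (by omega) (fun s' hF => ?_) ?_ ?_).mono le_rfl ?_
  · simp only [wp, Expr.eval, Expr.Fits, Op.apply, hm, State.setVar_var, reduceIte]
    omega
  · simp only [Expr.eval, Expr.Fits, (hF.var 2 rfl).trans h₁, true_and]
    omega
  · refine ⟨by simp, ⟨by simp, ?_, ?_, by simp, by simp, by simp⟩⟩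
    · simp [F₁.arr 7 rfl, h7]
    · simp [F₁.arr 7 rfl, h7]
  · intro j s' hF hj hv ⟨h, hlink⟩
    have f0 := (hF.arr 0 rfl).trans (F₁.arr 0 rfl)
    have f1 := (hF.arr 1 rfl).trans (F₁.arr 1 rfl)
    have ha' := ha (j / 2) (by omega)
    have hb' := hb (j / 2) (by omega)
    have hle := hlink.hh_le
    -- Handles the three stores for both parities of `j` at once; the cases differ only in the
    -- expressions stored.
    have key : ∀ x y z a b c, a = halfTail (s.arr 0) (s.arr 1) j →
        b = halfTail (s.arr 1) (s.arr 0) j → c = twin j →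
        x = Function.update (s'.arr 3) j a → y = Function.update (s'.arr 4) j b →
        z = Function.update (s'.arr 5) j c →
        ∀ h < j + 1, x h = halfTail (s.arr 0) (s.arr 1) h ∧
          y h = halfTail (s.arr 1) (s.arr 0) h ∧ z h = twin h := by
      rintro x y z a b c rfl rfl rfl rfl rfl rfl k hk
      by_cases c : k = j
      · subst c; simp
      · simp only [Function.update_of_ne c]
        exact h k (by omega)
    refine Runs.of_wp ?_
    simp only [insertStep, wp, Expr.eval, Expr.Fits, Op.apply, State.setVar_var,
      State.setVar_arr, State.setArr_var, State.setArr_arr, hv, f0, f1, reduceIte,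
      Nat.reduceEqDiff, h1W, ne_eq, ite_eq_right_iff, one_ne_zero, imp_false, not_not,
      Function.update_self]
    refine ⟨by omega, ⟨by omega, by omega, trivial⟩, fun c => ?_, fun c => ?_⟩
    · have e1 : s.arr 0 (j / 2) = halfTail (s.arr 0) (s.arr 1) j := by
        rw [halfTail, if_pos (by omega)]
      have e2 : s.arr 1 (j / 2) = halfTail (s.arr 1) (s.arr 0) j := by
        rw [halfTail, if_pos (by omega)]
      have e3 : j + 1 = twin j := by rw [twin, if_pos (by omega)]
      have := hle (s.arr 0 (j / 2))
      refine ⟨by omega, by omega, by omega, by omega, by omega, by omega, by omega, by omega,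
        by omega, by omega, by omega, key _ _ _ _ _ _ e1 e2 e3 rfl rfl rfl, ?_⟩
      rw [e1]
      exact hlink.insert
    · have e1 : s.arr 1 (j / 2) = halfTail (s.arr 0) (s.arr 1) j := by
        rw [halfTail, if_neg (by omega)]
      have e2 : s.arr 0 (j / 2) = halfTail (s.arr 1) (s.arr 0) j := by
        rw [halfTail, if_neg (by omega)]
      have e3 : j - 1 = twin j := by rw [twin, if_neg (by omega)]
      have := hle (s.arr 1 (j / 2))
      refine ⟨by omega, by omega, by omega, by omega, by omega, by omega, by omega, by omega,
        by omega, by omega, by omega, key _ _ _ _ _ _ e1 e2 e3 rfl rfl rfl, ?_⟩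
      rw [e1]
      exact hlink.insert
  · rintro s' hF ⟨h, hlink⟩
    have hP : ∀ P : ℕ → ℕ → Prop, (∃ h < 2 * m, P (s'.arr 3 h) (s'.arr 4 h)) ↔
        ∃ i < m, P (s.arr 0 i) (s.arr 1 i) ∨ P (s.arr 1 i) (s.arr 0 i) := by
      intro P
      rw [← exists_halfTail]
      refine exists_congr fun k => and_congr_right fun hk => ?_
      rw [(h k hk).1, (h k hk).2.1]
    have hlt : ∀ k < 2 * m, s'.arr 3 k < n ∧ s'.arr 4 k < n := by
      intro k hk
      rw [(h k hk).1, (h k hk).2.1, halfTail, halfTail]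
      have h1 := ha (k / 2) (by omega)
      have h2 := hb (k / 2) (by omega)
      split_ifs
      · exact ⟨h1, h2⟩
      · exact ⟨h2, h1⟩
    refine ⟨{
        n := n
        M := 2 * m
        tl := s'.arr 3
        hd := s'.arr 4
        tw := s'.arr 5
        nx := s'.arr 6
        hh := s'.arr 7
        w := s.arr 2
        tl_lt := fun k hk => (hlt k hk).1
        hd_lt := fun k hk => (hlt k hk).2
        tw_lt := fun k hk => by rw [(h k hk).2.2]; exact twin_lt hk
        tl_tw := fun k hk => by
          rw [(h k hk).2.2, (h _ (twin_lt hk)).1, halfTail_twin, (h k hk).2.1]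
        hd_tw := fun k hk => by
          rw [(h k hk).2.2, (h _ (twin_lt hk)).2.1, halfTail_twin, (h k hk).1]
        tw_tw := fun k hk => by
          rw [(h k hk).2.2, (h _ (twin_lt hk)).2.2, twin_twin]
        lt_hh := fun k hk => by rw [(h k hk).1]; exact hlink.lt_hh k hk
        hh_le := fun u _ => hlink.hh_le u
        tl_hh := fun u _ h0 => by
          have := hlink.hh_le u
          rw [(h _ (by omega)).1]; exact hlink.tl_hh u h0
        nx_le := hlink.nx_le
        lt_nx := fun k hk i hi hik => by
          rw [(h k hk).1, (h i (by omega)).1] at hik; exact hlink.lt_nx k hk i hi hik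
        tl_nx := fun k hk h0 => by
          have := hlink.nx_le k hk
          rw [(h k hk).1, (h _ (by omega)).1]; exact hlink.tl_nx k hk h0
        n_pos := hn0
        w_pos := hw
        exists_tl := fun u hu => (hP fun x _ => x = u).2 (hadj u hu) }, ?_, rfl, rfl, rfl, hP⟩
    exact ⟨(hF.var 0 rfl).trans ((F₁.var 0 rfl).trans hn), (hF.var 2 rfl).trans h₁,
      (hF.arr 2 rfl).trans (F₁.arr 2 rfl), rfl, rfl, rfl, rfl, rfl⟩

/-- `tl` maps the half-edges onto the vertices, as none is isolated. This lets `m` absorb `n` in the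
running time. -/
theorem Net.n_le_M (N : Net) : N.n ≤ N.M := by
  have : range N.n ⊆ (range N.M).image N.tl := fun u hu => by
    obtain ⟨h, hh, hu⟩ := N.exists_tl u (mem_range.1 hu)
    exact mem_image.2 ⟨h, mem_range.2 hh, hu⟩
  simpa using (card_le_card this).trans card_image_le

theorem runs_minRatioProgram {s : State} {n m : ℕ} (hn : s.var 0 = n) (hm : s.var 1 = m)
    (hW : 2 * n + 2 * m + 4 +
      2 * ((∑ u ∈ range n, s.arr 2 u) * ∑ u ∈ range n, s.arr 2 u) ≤ W)
    (ha : ∀ i < m, s.arr 0 i < n) (hb : ∀ i < m, s.arr 1 i < n)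
    (h7 : ∀ u, s.arr 7 u = 0) (hn0 : 0 < n) (hw : ∀ u < n, 0 < s.arr 2 u)
    (hadj : ∀ u < n, ∃ i < m, s.arr 0 i = u ∨ s.arr 1 i = u) {k : ℕ}
    (hk : (∑ u ∈ range n, s.arr 2 u) * ∑ u ∈ range n, s.arr 2 u < 2 ^ k) :
    Runs W minRatioProgram (n * (k + 1) * (294000 * m ^ 2)) s fun s' =>
      ∃ N : Net, N.n = n ∧ N.w = s.arr 2 ∧
        (∀ P : ℕ → ℕ → Prop, (∃ h < N.M, P (N.tl h) (N.hd h)) ↔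
          ∃ i < m, P (s.arr 0 i) (s.arr 1 i) ∨ P (s.arr 1 i) (s.arr 0 i)) ∧
        N.IsLower (s'.var 0) (s'.var 1) ∧
        ∃ S ⊆ range N.n, S.Nonempty ∧ s'.var 0 = N.wt (N.nb S) ∧ s'.var 1 = N.wt S := by
  have hsq := Nat.le_mul_self (∑ u ∈ range n, s.arr 2 u)
  have hV : n ≤ ∑ u ∈ range n, s.arr 2 u := by
    simpa using card_nsmul_le_sum (range n) (s.arr 2) 1 fun u hu => hw u (mem_range.1 hu)
  have hrun := Runs.seq' (c₂ := build ;; minimize ;; 0 ≔ .var 4 ;; 1 ≔ .var 5)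
    (T₂ := (4 + (2 * m + 1) * 60) + ((n + 3) * ((k + 1) * (1200 * (2 * n + 2 * m + 1) ^ 2)) + 4))
    (Q := fun s' => ∃ N : Net, (N.n = n ∧ N.M = 2 * m) ∧ N.w = s.arr 2 ∧
        (∀ P : ℕ → ℕ → Prop, (∃ h < N.M, P (N.tl h) (N.hd h)) ↔
          ∃ i < m, P (s.arr 0 i) (s.arr 1 i) ∨ P (s.arr 1 i) (s.arr 0 i)) ∧
        N.IsLower (s'.var 0) (s'.var 1) ∧
        ∃ S ⊆ range N.n, S.Nonempty ∧ s'.var 0 = N.wt (N.nb S) ∧ s'.var 1 = N.wt S)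
    (runs_sumWeights (W := W) (s := s) hn (by omega)) fun s₁ F₁ h₁ =>
    Runs.seq' (runs_build (n := n) (m := m) ((F₁.var 0 rfl).trans hn) ((F₁.var 1 rfl).trans hm)
      (by omega) (by rwa [F₁.arr 0 rfl]) (by rwa [F₁.arr 1 rfl]) (by rwa [F₁.arr 7 rfl]) hn0
      (by rwa [F₁.arr 2 rfl]) (by rwa [F₁.arr 0 rfl, F₁.arr 1 rfl])) fun s₂ F₂ h₂ => by
        obtain ⟨N, hL, hNn, hNM, hNw, hNP⟩ := h₂
        rw [F₁.arr 2 rfl] at hNw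
        rw [F₁.arr 0 rfl, F₁.arr 1 rfl] at hNP
        have hwt : N.wt (range N.n) = ∑ u ∈ range n, s.arr 2 u := by rw [Net.wt, hNn, hNw]
        rw [← hwt] at hW hk h₁ hV hsq
        subst hNn
        have h1 := Net.runs_minimize (W := W) hL (by rw [hNM]; omega) ((F₂.var 3 rfl).trans h₁) hk
        rw [hNM] at h1
        refine Runs.seq' h1 fun s₃ F₃ h₃ => Runs.of_wp (c := .seq _ _) ?_
        simp only [wp, Expr.eval, Expr.Fits, State.setVar_var, reduceIte, Nat.reduceEqDiff]
        obtain ⟨h₃, S, hS, hS0, h4, h5⟩ := h₃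
        have c1 := N.wt_mono hS
        have c2 := N.wt_mono (N.nb_subset S)
        exact ⟨by omega, by omega, N, ⟨rfl, hNM⟩, hNw, hNP, h₃, S, hS, hS0, h4, h5⟩
  -- The network that the run provides is used here only for `n ≤ M = 2 * m`.
  have hnm : n ≤ 2 * m := by
    obtain ⟨-, -, -, -, N, ⟨h1, h2⟩, -⟩ := hrun
    have := N.n_le_M
    omega
  refine hrun.mono ?_ ?_
  -- With `n ≤ 2 * m`, `1 ≤ m` and `n + 3 ≤ 4 * n`, the iteration contributes `4 * 1200 * 49 =
  -- 235200`; the remaining `58800` covers the linear parts.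
  · have hA : 2 * n + 2 * m + 1 ≤ 7 * m := by omega
    have hA2 : (2 * n + 2 * m + 1) ^ 2 ≤ 49 * m ^ 2 :=
      (Nat.pow_le_pow_left hA 2).trans_eq (by ring)
    have hm2 : m ≤ m ^ 2 := Nat.le_self_pow two_ne_zero _
    have h1 : (n + 3) * ((k + 1) * (1200 * (2 * n + 2 * m + 1) ^ 2)) ≤
        (4 * n) * ((k + 1) * (1200 * (49 * m ^ 2))) := by
      gcongr
      omega
    have h2 : 58800 * m ^ 2 ≤ n * (k + 1) * (58800 * m ^ 2) :=
      Nat.le_mul_of_pos_left _ (Nat.mul_pos hn0 (by omega))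
    have h3 : n * (k + 1) * (294000 * m ^ 2) =
        (4 * n) * ((k + 1) * (1200 * (49 * m ^ 2))) + n * (k + 1) * (58800 * m ^ 2) := by ring
    omega
  · rintro s' - ⟨N, ⟨h1, -⟩, h2⟩
    exact ⟨N, h1, h2⟩

/-! ### From the network back to the graph -/

section Transfer

variable {n : ℕ} {G : SimpleGraph (Fin n)} {w : Fin n → ℕ} {N : Net}

theorem wt_map (hw : ∀ v : Fin n, N.w v = w v) (S : Finset (Fin n)) :
    N.wt (S.map Fin.valEmbedding) = AlphaRatio.weight w S := by
  simp [Net.wt, AlphaRatio.weight, hw]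

theorem nb_map (hadj : ∀ u v : Fin n, G.Adj u v ↔ ∃ h < N.M, N.tl h = u ∧ N.hd h = v)
    (hn : N.n = n) (S : Finset (Fin n)) :
    N.nb (S.map Fin.valEmbedding) = (AlphaRatio.nbhd G S).map Fin.valEmbedding := by
  ext v
  simp only [Net.mem_nb, mem_map, Fin.valEmbedding_apply, AlphaRatio.nbhd, mem_filter, mem_univ,
    true_and]
  constructor
  · rintro ⟨h, hh, ⟨u, hu, e1⟩, e2⟩
    have hv : v < n := hn ▸ e2 ▸ N.hd_lt h hh
    exact ⟨⟨v, hv⟩, ⟨u, hu, (hadj u ⟨v, hv⟩).2 ⟨h, hh, e1.symm, e2⟩⟩, rfl⟩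
  · rintro ⟨v, ⟨u, hu, huv⟩, rfl⟩
    obtain ⟨h, hh, e1, e2⟩ := (hadj u v).1 huv
    exact ⟨h, hh, ⟨u, hu, e1.symm⟩, e2⟩

theorem exists_map_eq {S : Finset ℕ} (hS : S ⊆ range n) :
    ∃ T : Finset (Fin n), T.map Fin.valEmbedding = S := by
  refine ⟨univ.filter fun v => (v : ℕ) ∈ S, ?_⟩
  ext v
  simp only [mem_map, mem_filter, mem_univ, true_and, Fin.valEmbedding_apply]
  exact ⟨fun ⟨u, hu, e⟩ => e ▸ hu, fun hv => ⟨⟨v, mem_range.1 (hS hv)⟩, hv, rfl⟩⟩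

theorem map_subset_range (S : Finset (Fin n)) : S.map Fin.valEmbedding ⊆ range n := by
  intro v hv
  obtain ⟨u, -, rfl⟩ := mem_map.1 hv
  exact mem_range.2 u.2

theorem isMinRatio_of_isLower (hn : N.n = n) (hw : ∀ v : Fin n, N.w v = w v)
    (hadj : ∀ u v : Fin n, G.Adj u v ↔ ∃ h < N.M, N.tl h = u ∧ N.hd h = v) {S : Finset ℕ}
    (hS : S ⊆ range N.n) (hS0 : S.Nonempty) (hlow : N.IsLower (N.wt (N.nb S)) (N.wt S)) :
    AlphaRatio.IsMinRatio G w ((N.wt (N.nb S) : ℚ) / N.wt S) := by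
  constructor
  · obtain ⟨T, rfl⟩ := exists_map_eq (hn ▸ hS)
    refine ⟨T, map_nonempty.1 hS0, ?_⟩
    rw [nb_map hadj hn, wt_map hw, wt_map hw, AlphaRatio.ratio]
  · rintro _ ⟨T, hT, rfl⟩
    have hT' : T.map Fin.valEmbedding ⊆ range N.n := by rw [hn]; exact map_subset_range T
    have h1 : 0 < N.wt (T.map Fin.valEmbedding) :=
      Net.wt_pos hT' (map_nonempty.2 hT)
    have h2 := hlow _ hT'
    rw [AlphaRatio.ratio, ← wt_map hw, ← wt_map hw, ← nb_map hadj hn,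
      div_le_div_iff₀ (by exact_mod_cast Net.wt_pos hS hS0) (by exact_mod_cast h1)]
    rw [mul_comm (N.wt S)] at h2
    exact_mod_cast h2

end Transfer

theorem AlphaRatio.IsEdgeList.ncard_eq {n : ℕ} {G : SimpleGraph (Fin n)}
    {L : List (Fin n × Fin n)} (hL : AlphaRatio.IsEdgeList G L) : G.edgeSet.ncard = L.length := by
  have : G.edgeSet = ((L.map fun p => s(p.1, p.2)).toFinset : Set (Sym2 (Fin n))) := by
    ext e
    rw [List.coe_toFinset, Set.mem_ofPred_eq, hL.2]
  rw [this, Set.ncard_coe_finset, List.toFinset_card_of_nodup hL.1, List.length_map]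

theorem AlphaRatio.IsEdgeList.adj_iff {n : ℕ} {G : SimpleGraph (Fin n)}
    {L : List (Fin n × Fin n)} (hL : AlphaRatio.IsEdgeList G L) (w : Fin n → ℕ) (u v : Fin n) :
    G.Adj u v ↔ ∃ i < L.length,
      ((AlphaRatio.inputState w L).arr 0 i = u ∧ (AlphaRatio.inputState w L).arr 1 i = v) ∨
      ((AlphaRatio.inputState w L).arr 1 i = u ∧ (AlphaRatio.inputState w L).arr 0 i = v) := by
  rw [← SimpleGraph.mem_edgeSet, ← hL.2, List.mem_map]
  constructor
  · rintro ⟨p, hp, he⟩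
    obtain ⟨i, hi, rfl⟩ := List.getElem_of_mem hp
    refine ⟨i, hi, ?_⟩
    simp only [AlphaRatio.inputState, hi, reduceIte, one_ne_zero, dif_pos, Fin.val_inj]
    rw [Sym2.eq_iff] at he
    exact he.imp_right And.symm
  · rintro ⟨i, hi, h⟩
    simp only [AlphaRatio.inputState, hi, reduceIte, one_ne_zero, dif_pos, Fin.val_inj] at h
    exact ⟨L[i], List.getElem_mem hi, Sym2.eq_iff.2 (h.imp_right And.symm)⟩

/-- Each of `2 * n`, `2 * m` and `4` is at most `V²`, so the left side is at most `5 * V² ≤ 2³ * V²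
≤ V⁵`. -/
theorem sum_le_pow_five {n m V : ℕ} (hn : n ≤ V) (hm : m ≤ n.choose 2) (hV : 2 ≤ V) :
    2 * n + 2 * m + 4 + 2 * (V * V) ≤ V ^ 5 := by
  have h1 : 2 * m ≤ V * V := by
    have h2 : m ≤ V * (V - 1) / 2 := hm.trans ((Nat.choose_le_choose 2 hn).trans_eq
      (Nat.choose_two_right V))
    have h3 : V * (V - 1) ≤ V * V := Nat.mul_le_mul_left _ (Nat.sub_le _ _)
    omega
  have h4 : 2 * V ≤ V * V := Nat.mul_le_mul_right _ hV
  have h5 : 2 ^ 3 * (V * V) ≤ V ^ 3 * (V * V) :=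
    Nat.mul_le_mul_right _ (Nat.pow_le_pow_left hV 3)
  have h6 : V ^ 5 = V ^ 3 * (V * V) := by ring
  omega

/-- With `ℓ = Nat.log 2 V ≥ 1` the left side is `2ℓ + 3 ≤ 5ℓ`, and `ℓ * log 2 ≤ log V` with `log 2 >
1 / 2`. -/
theorem natLog_le_two_mul_log {V : ℕ} (hV : 2 ≤ V) :
    (2 * (Nat.log 2 V + 1) + 1 : ℝ) ≤ 10 * Real.log V := by
  have h1 : 1 ≤ Nat.log 2 V := Nat.log_pos one_lt_two hV
  have h2 : (2 : ℝ) ^ Nat.log 2 V ≤ V := by exact_mod_cast Nat.pow_log_le_self 2 (by omega)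
  have h3 := Real.log_le_log (by positivity) h2
  rw [Real.log_pow] at h3
  have h4 : (1 : ℝ) ≤ Nat.log 2 V := by exact_mod_cast h1
  have h5 := Real.log_two_gt_d9
  nlinarith

theorem theorem1 :
    ∃ (P : WordRAM.Cmd) (c : ℕ) (C : ℝ),
      ∀ (n : ℕ) (G : SimpleGraph (Fin n)) (w : Fin n → ℕ) (L : List (Fin n × Fin n)),
        0 < n → (∀ v, ∃ u, G.Adj v u) → (∀ v, 0 < w v) → AlphaRatio.IsEdgeList G L →
        ∃ (t : ℕ) (s : WordRAM.State),
          WordRAM.Exec (AlphaRatio.weight w Finset.univ ^ c) P (AlphaRatio.inputState w L) t s ∧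
          (t : ℝ) ≤ C * ((n : ℝ) * (G.edgeSet.ncard : ℝ) ^ 2 *
            Real.log (AlphaRatio.weight w Finset.univ : ℝ)) ∧
          0 < s.var 1 ∧
          AlphaRatio.IsMinRatio G w ((s.var 0 : ℚ) / (s.var 1 : ℚ)) := by
  refine ⟨minRatioProgram, 5, 2940000, fun n G w L hn hiso hw hL => ?_⟩
  have hadj := hL.adj_iff w
  rw [hL.ncard_eq]
  have hm : L.length ≤ n.choose 2 := by
    classical
    have := G.card_edgeFinset_le_card_choose_two
    rwa [← Set.ncard_coe_finset, SimpleGraph.coe_edgeFinset, hL.ncard_eq, Fintype.card_fin] at this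
  have hV : n ≤ AlphaRatio.weight w univ := by
    simpa [AlphaRatio.weight] using card_nsmul_le_sum univ w 1 fun v _ => hw v
  -- A single vertex would be isolated. Hence `w(V) ≥ 2`, which keeps the logarithm away from `0`.
  have hn2 : 2 ≤ n := by
    by_contra hc
    obtain rfl : n = 1 := by omega
    obtain ⟨u, hu⟩ := hiso 0
    exact hu.ne (Subsingleton.elim _ _)
  have h2 : ∀ v : Fin n, (AlphaRatio.inputState w L).arr 2 v = w v := fun v => by
    simp [AlphaRatio.inputState]
  have hsum : ∑ u ∈ range n, (AlphaRatio.inputState w L).arr 2 u = AlphaRatio.weight w univ := by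
    rw [← Fin.sum_univ_eq_sum_range, AlphaRatio.weight]
    exact sum_congr rfl fun v _ => h2 v
  -- The scaling parameter is at most `w(V)²`, so twice the binary length of `w(V)` bounds the
  -- number of phases.
  have hlog : AlphaRatio.weight w univ * AlphaRatio.weight w univ <
      2 ^ (2 * (Nat.log 2 (AlphaRatio.weight w univ) + 1)) := by
    have := Nat.lt_pow_succ_log_self one_lt_two (AlphaRatio.weight w univ)
    rw [two_mul, pow_add]
    exact Nat.mul_self_lt_mul_self this
  obtain ⟨t, s, hexec, ht, N, hNn, hNw, hNP, hlow, S, hS, hS0, e0, e1⟩ :=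
    runs_minRatioProgram (s := AlphaRatio.inputState w L) (n := n) (m := L.length)
      (W := AlphaRatio.weight w univ ^ 5) rfl rfl
      (by rw [hsum]; exact sum_le_pow_five hV hm (hn2.trans hV))
      (fun i hi => by simp [AlphaRatio.inputState, hi])
      (fun i hi => by simp [AlphaRatio.inputState, hi])
      (fun u => by simp [AlphaRatio.inputState]) hn
      (fun u hu => by rw [h2 ⟨u, hu⟩]; exact hw _)
      (fun u hu => by
        obtain ⟨v, hv⟩ := hiso ⟨u, hu⟩
        obtain ⟨i, hi, h⟩ := (hadj _ _).1 hv
        exact ⟨i, hi, h.imp And.left And.left⟩)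
      (by rw [hsum]; exact hlog)
  refine ⟨t, s, hexec, ?_, e1 ▸ Net.wt_pos hS hS0, ?_⟩
  · have h3 := natLog_le_two_mul_log (hn2.trans hV)
    have h4 : (0 : ℝ) ≤ n * (L.length : ℝ) ^ 2 := by positivity
    calc (t : ℝ) ≤ ((n * (2 * (Nat.log 2 (AlphaRatio.weight w univ) + 1) + 1) *
          (294000 * L.length ^ 2) : ℕ) : ℝ) := by exact_mod_cast ht
      _ = 294000 * (n * (L.length : ℝ) ^ 2) *
          (2 * (Nat.log 2 (AlphaRatio.weight w univ) + 1) + 1) := by push_cast; ring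
      _ ≤ 294000 * (n * (L.length : ℝ) ^ 2) * (10 * Real.log (AlphaRatio.weight w univ)) :=
          mul_le_mul_of_nonneg_left h3 (by positivity)
      _ = 2940000 * (n * (L.length : ℝ) ^ 2 * Real.log (AlphaRatio.weight w univ)) := by ring
  · rw [e0, e1] at hlow ⊢
    refine isMinRatio_of_isLower hNn (fun v => by rw [hNw, h2]) (fun u v => ?_) hS hS0 hlow
    rw [hadj, hNP fun a b => a = u ∧ b = v]
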